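/- Theorem (regret of R-ed-UCB, stochastic setting). Consider a $K$-armed bandit ($K\ge 1$): when arm $i$ is pulled at round $t$ for the $n$-th time ($t,n\ge 1$), the reward is drawn from a probability distribution $\nu_i(t,n)$ on $\mathbb R$ with mean $\mu_i(t,n)\in[0,1]$, and it is $\sigma^2$-subgaussian, i.e. $\mathbb E_{R\sim\nu_i(t,n)}[e^{\lambda(R-\mu_i(t,n))}]\le e^{\sigma^2\lambda^2/2}$ for all $\lambda\in\mathbb R$, where $\sigma>0$. The bandit is rising and rested: $\mu_i(t,n)=\mu_i(n)$ does not depend on $t$, and the increments $\gamma_i(n)=\mu_i(n+1)-\mu_i(n)$ satisfy $\gamma_i(n)\ge 0$ and $\gamma_i(n+1)\le\gamma_i(n)$ for all $n\ge 1$. A policy $\pi$ maps the history $(I_l,R_l)_{l<t}$ measurably to the arm $I_t$; $N_{i,t}$ is the number of pulls of arm $i$ in the rounds $1,\dots,t$; $J_\mu(\pi,T)=\mathbb E\big[\sum_{t=1}^T\mu_{I_t}(t,N_{I_t,t})\big]$; and the expected regret is $R_\mu(\pi,T)=\sup_{\pi'}J_\mu(\pi',T)-J_\mu(\pi,T)$,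 the supremum being over all policies. For $q\in[0,1]$ put $\Upsilon_\mu(M,q)=\sum_{l=1}^{M-1}\max_{i}\gamma_i(l)^q$ (with $0^0=1$). R-ed-UCB with parameters $\epsilon\in(0,1/2)$ and $\alpha>2$ pulls, at every round $t$, an arm $I_t\in\arg\max_i B_i(t)$ (ties broken in any way), where, with $N=N_{i,t-1}$, $h=\lfloor\epsilon N\rfloor$ and $R_{i,l}$ the reward of the $l$-th pull of arm $i$, $$B_i(t)=\frac1h\sum_{l=N-h+1}^{N}\Big(R_{i,l}+(t-l)\frac{R_{i,l}-R_{i,l-h}}{h}\Big)+\sigma\,(t-N+h-1)\sqrt{\frac{10\log(1/\delta_t)}{h^3}},\qquad \delta_t=t^{-\alpha},$$ if $h\ge 1$, and $B_i(t)=+\infty$ if $h=0$. Then the expected regret of R-ed-UCB is, for every $q\in[0,1]$, of order $$R_\mu(\text{R-ed-UCB},T)\le O\big(\mathcal B\big),\qquad \mathcal B=\frac K\epsilon(\sigma T)^{2/3}(\alpha\log T)^{1/3}+\frac{K\,T^q}{1-2\epsilon}\,\Upsilon_\mu\Big(\Big\lceil(1-2\epsilon)\frac TK\Big\rceil,q\Big),$$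 in the following precise sense. There is an absolute constant $C>0$ and, for all $\sigma>0$ and $\alpha>2$, a number $T_0=T_0(\sigma,\alpha)$ and, for every $\epsilon\in(0,1/2)$, a constant $D=D(\sigma,\alpha,\epsilon)>0$, such that for every $K\ge1$, every bandit as above, every policy that is an instance of R-ed-UCB, every $q\in[0,1]$ and every $T\ge 2$: (i) $R_\mu(\text{R-ed-UCB},T)\le D\,\mathcal B$; and (ii) if $T\ge T_0$ and $(1-2\epsilon)T>K$, then $R_\mu(\text{R-ed-UCB},T)\le C\,\mathcal B$. -/

import Mathlib

open MeasureTheory ProbabilityTheory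

noncomputable section

namespace RisingBandit

/-- A `K`-armed bandit: `law i t n` is the distribution of the reward of arm `i` when it is pulled
at round `t` for the `n`-th time. Rounds and numbers of pulls are counted from `1`; the values of
`law` at `t = 0` or `n = 0` are never used. -/
structure MAB (K : ℕ) where
  law : Fin K → ℕ → ℕ → Measure ℝ
  isProb : ∀ i t n, IsProbabilityMeasure (law i t n)

/-- The payoff `μ_i(t, n)`, the expected reward. -/
def MAB.payoff {K : ℕ} (ν : MAB K) (i : Fin K) (t n : ℕ) : ℝ := ∫ x, x ∂(ν.law i t n)

/-- The payoffs lie in `[0, 1]`. -/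
def MAB.IsBounded {K : ℕ} (ν : MAB K) : Prop :=
  ∀ i t n, 1 ≤ t → 1 ≤ n → 0 ≤ ν.payoff i t n ∧ ν.payoff i t n ≤ 1

/-- The rewards are `σ²`-subgaussian: `E[exp (s (R - μ))] ≤ exp (σ² s² / 2)` for all real `s`. -/
def MAB.IsSubgaussian {K : ℕ} (ν : MAB K) (σ : ℝ) : Prop :=
  ∀ i t n, 1 ≤ t → 1 ≤ n →
    HasSubgaussianMGF (fun x => x - ν.payoff i t n) (Real.toNNReal (σ ^ 2)) (ν.law i t n)

/-- All arms are rested: the payoff depends on the number of pulls only. -/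
def MAB.IsRested {K : ℕ} (ν : MAB K) : Prop :=
  ∀ i t t' n, 1 ≤ t → 1 ≤ t' → 1 ≤ n → ν.payoff i t n = ν.payoff i t' n

/-- The payoff `μ_i(n)` of a rested arm. -/
def MAB.restedPayoff {K : ℕ} (ν : MAB K) (i : Fin K) (n : ℕ) : ℝ := ν.payoff i 1 n

/-- The increment `γ_i(n) = μ_i(n + 1) - μ_i(n)` of a rested arm. -/
def MAB.incr {K : ℕ} (ν : MAB K) (i : Fin K) (n : ℕ) : ℝ :=
  ν.restedPayoff i (n + 1) - ν.restedPayoff i n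

/-- A rising rested bandit: rested, with non-decreasing and concave payoffs. -/
structure MAB.IsRisingRested {K : ℕ} (ν : MAB K) : Prop where
  rested : ν.IsRested
  nonDecreasing : ∀ i n, 1 ≤ n → 0 ≤ ν.incr i n
  concave : ∀ i n, 1 ≤ n → ν.incr i (n + 1) - ν.incr i n ≤ 0

/-- The cumulative increment `Υ(M, q) = ∑_{l=1}^{M-1} max_i γ_i(l)^q`. -/
def MAB.cumIncr {K : ℕ} (ν : MAB K) (M : ℕ) (q : ℝ) : ℝ :=
  ∑ l ∈ Finset.Ico 1 M, ⨆ i : Fin K, ν.incr i l ^ q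

/-- The histories `(I_1, R_1), …, (I_t, R_t)` of length `t`; the entry `s : Fin t` is the
observation of round `s + 1`. -/
abbrev Hist (K t : ℕ) : Type := Fin t → Fin K × ℝ

/-- The number of pulls of arm `i` in the history `h`. -/
def pulls {K t : ℕ} (h : Hist K t) (i : Fin K) : ℕ :=
  (Finset.univ.filter fun s : Fin t => (h s).1 = i).card

/-- The number of pulls of arm `i` up to and including the round of the entry `s`. -/
def pullsUpTo {K t : ℕ} (h : Hist K t) (s : Fin t) (i : Fin K) : ℕ :=
  (Finset.univ.filter fun s' : Fin t => s' ≤ s ∧ (h s').1 = i).card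

/-- The reward observed at the `l`-th pull of arm `i`, for `1 ≤ l ≤ pulls h i`: the sum has
exactly one non-trivial term, the round at which arm `i` was pulled for the `l`-th time. -/
def pullReward {K t : ℕ} (h : Hist K t) (i : Fin K) (l : ℕ) : ℝ :=
  ∑ s : Fin t, if (h s).1 = i ∧ pullsUpTo h s i = l then (h s).2 else 0

/-- A (non-stationary, deterministic) policy: after a history of length `t` it selects the arm to
be pulled at round `t + 1`. -/
structure Policy (K : ℕ) where
  act : (t : ℕ) → Hist K t → Fin K
  measurable_act : ∀ t, Measurable (act t)

theorem measurable_pulls {K t : ℕ} (i : Fin K) : Measurable fun h : Hist K t => pulls h i := by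
  have hs : (fun h : Hist K t => pulls h i)
      = fun h => ∑ s : Fin t, if (h s).1 = i then 1 else 0 := by
    funext h
    exact Finset.card_filter _ _
  rw [hs]
  refine Finset.measurable_sum _ fun s _ => ?_
  refine Measurable.ite ?_ measurable_const measurable_const
  exact (measurable_fst.comp (measurable_pi_apply s)) (measurableSet_singleton i)

/-- The conditional distribution of the reward of round `t + 1` given the history of the first
`t` rounds, when the arm is chosen by the policy `π`. -/
def rewardKernel {K : ℕ} (ν : MAB K) (π : Policy K) (t : ℕ) : Kernel (Hist K t) ℝ where
  toFun h := ν.law (π.act t h) (t + 1) (pulls h (π.act t h) + 1)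
  measurable' := by
    have h1 : Measurable fun h : Hist K t => (π.act t h, fun i => pulls h i) :=
      (π.measurable_act t).prodMk (measurable_pi_lambda _ fun i => measurable_pulls i)
    have h2 : Measurable fun p : Fin K × (Fin K → ℕ) => ν.law p.1 (t + 1) (p.2 p.1 + 1) :=
      measurable_of_countable _
    exact h2.comp h1

instance {K : ℕ} (ν : MAB K) (π : Policy K) (t : ℕ) : IsMarkovKernel (rewardKernel ν π t) :=
  ⟨fun _ => ν.isProb _ _ _⟩

/-- The distribution of the history of the first `t` rounds when `π` is played in `ν`. -/
def histLaw {K : ℕ} (ν : MAB K) (π : Policy K) : (t : ℕ) → Measure (Hist K t)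
  | 0 => Measure.dirac Fin.elim0
  | t + 1 => ((histLaw ν π t) ⊗ₘ (rewardKernel ν π t)).map
      fun p => Fin.snoc (α := fun _ => Fin K × ℝ) p.1 (π.act t p.1, p.2)

theorem measurable_snoc {K : ℕ} (π : Policy K) (t : ℕ) :
    Measurable fun p : Hist K t × ℝ =>
      (Fin.snoc (α := fun _ => Fin K × ℝ) p.1 (π.act t p.1, p.2) : Hist K (t + 1)) := by
  refine measurable_pi_lambda _ fun s => ?_
  induction s using Fin.lastCases with
  | last =>
    simp only [Fin.snoc_last]
    exact ((π.measurable_act t).comp measurable_fst).prodMk measurable_snd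
  | cast s =>
    simp only [Fin.snoc_castSucc]
    exact (measurable_pi_apply s).comp measurable_fst

instance histLaw_isProb {K : ℕ} (ν : MAB K) (π : Policy K) :
    (t : ℕ) → IsProbabilityMeasure (histLaw ν π t)
  | 0 => by unfold histLaw; infer_instance
  | t + 1 => by
    have := histLaw_isProb ν π t
    unfold histLaw
    exact Measure.isProbabilityMeasure_map (measurable_snoc π t).aemeasurable

/-- The expected cumulative reward `J(π, T) = E[∑_{t ≤ T} μ_{I_t}(t, N_{I_t,t})]`. -/
def expReward {K : ℕ} (ν : MAB K) (π : Policy K) (T : ℕ) : ℝ :=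
  ∫ h, ∑ s : Fin T, ν.payoff (h s).1 (s + 1) (pullsUpTo h s (h s).1) ∂(histLaw ν π T)

/-- The expected cumulative regret: the optimal expected cumulative reward over all policies
minus the one of `π`. -/
def regret {K : ℕ} (ν : MAB K) (π : Policy K) (T : ℕ) : ℝ :=
  (⨆ π' : Policy K, expReward ν π' T) - expReward ν π T

/-- The windowed estimator of arm `i` at round `t + 1`, with window `w`, from the history of the
first `t` rounds. -/
def estimator {K t : ℕ} (h : Hist K t) (i : Fin K) (w : ℕ) : EReal :=
  if 1 ≤ w ∧ w ≤ pulls h i / 2 then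
    (((1 / (w : ℝ)) * ∑ l ∈ Finset.Icc (pulls h i - w + 1) (pulls h i),
      (pullReward h i l + (((t + 1 : ℕ) : ℝ) - (l : ℝ)) *
        ((pullReward h i l - pullReward h i (l - w)) / (w : ℝ))) : ℝ) : EReal)
  else ⊤

/-- The confidence bonus of arm `i` at round `t + 1`, with window `w` and confidence `δ`. -/
def bonus {K t : ℕ} (σ : ℝ) (h : Hist K t) (i : Fin K) (w : ℕ) (δ : ℝ) : EReal :=
  if w = 0 then ⊤
  else ((σ * (((t + 1 : ℕ) : ℝ) - (pulls h i : ℝ) + (w : ℝ) - 1) *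
    Real.sqrt (10 * Real.log (1 / δ) / (w : ℝ) ^ 3) : ℝ) : EReal)

/-- The exploration index of arm `i` at round `t + 1`: estimator plus bonus, with window
`⌊ε N⌋`, where `N` is the number of past pulls of arm `i`, and confidence `(t + 1) ^ (-α)`. -/
def index {K t : ℕ} (σ ε α : ℝ) (h : Hist K t) (i : Fin K) : EReal :=
  estimator h i ⌊ε * (pulls h i : ℝ)⌋₊ +
    bonus σ h i ⌊ε * (pulls h i : ℝ)⌋₊ (((t + 1 : ℕ) : ℝ) ^ (-α))

/-- `π` is an instance of R-ed-UCB: at every round it pulls an arm of maximal index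
(ties may be broken in any way). -/
def Policy.IsREdUCB {K : ℕ} (π : Policy K) (σ ε α : ℝ) : Prop :=
  ∀ (t : ℕ) (h : Hist K t) (j : Fin K), index σ ε α h j ≤ index σ ε α h (π.act t h)

/-- The expression `(K/ε) (σT)^{2/3} (α log T)^{1/3} + K T^q/(1-2ε) · Υ(⌈(1-2ε)T/K⌉, q)`. -/
def regretRate {K : ℕ} (ν : MAB K) (σ ε α q : ℝ) (T : ℕ) : ℝ :=
  (K : ℝ) / ε * (σ * (T : ℝ)) ^ (2 / 3 : ℝ) * (α * Real.log (T : ℝ)) ^ (1 / 3 : ℝ) +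
    (K : ℝ) * (T : ℝ) ^ q / (1 - 2 * ε) * ν.cumIncr ⌈(1 - 2 * ε) * (T : ℝ) / (K : ℝ)⌉₊ q

end RisingBandit

end

/-!
In a rising rested bandit the cumulative payoff of an arm is convex in the number of its pulls, so
no policy does better than pulling one best arm `i₀` in all rounds (`expReward_le`). The regret is
therefore at most the expected sum over the rounds `t` of `μ_{i₀}(t) - μ_{I_t}(N + 1)`, where `N` is
the number of earlier pulls of `I_t`.

With window `w = ⌊ε N⌋ ≥ 1`, the mean of the estimator of an arm is an average of linear
extrapolations to the time `t`. By concavity it is at least `μ_i(t)` (`IsRising.le_extrap`) and at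
most `μ_i(N + 1) + t γ_i(N - 2 w + 1)` (`IsRising.extrap_le`). The weights of the rewards in the
estimator have a sum of squares of at most `5 (t - N + w - 1)² / w³`
(`sum_extrapWeight_sq_le`), and an exponential supermartingale (`lintegral_exp_compensatedSum_le`)
turns this into a deviation probability of at most `2 t^{-α}` for each arm and each `N`. As `α > 2`,
the union bounds over `N < t` and over the arms are summable in `t`
(`measure_not_concentrated_le`). Outside these events, optimism gives
`μ_{i₀}(t) ≤ μ_{I_t}(N + 1) + F(N)` with `F = roundBound` a deterministic function of the number of
pulls: the truncated width `min (1, (Y / w)^{3/2})`, where `Y` is a multiple of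
`(σ T)^{2/3} (α log T)^{1/3}`, plus the bias `min (1, T γ) ≤ T^q γ^q`
(`payoff_le_of_concentrated`).

It remains to sum `F` along the pulls. Every window size occurs at most `1 / ε + 1` times per arm
and `∑_w min (1, (Y / w)^{3/2}) = O(Y)`, which gives the first term of the rate
(`sum_width_floor_le`). For the second one, `N - 2 w + 1 ≥ ⌈(1 - 2 ε) N⌉`, every value of this
ceiling occurs at most `1 / (1 - 2 ε) + 1` times per arm, and the terms beyond the level
`⌈(1 - 2 ε) T / K⌉` are bounded by the average of those below it (`sum_ceil_le`). For small
horizons, and when `(1 - 2 ε) T ≤ K`, the trivial bound `T` on the regret suffices.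
-/

noncomputable section

namespace RisingBandit

/-! ### Sums along maps with short fibres -/

theorem card_le_of_gap (s : Finset ℕ) {c : ℝ} (hc : 0 ≤ c)
    (h : ∀ x ∈ s, ∀ y ∈ s, (y : ℝ) - x ≤ c) : (s.card : ℝ) ≤ c + 1 := by
  rcases s.eq_empty_or_nonempty with rfl | hs
  · simp only [Finset.card_empty, Nat.cast_zero]
    linarith
  · have hsub : s ⊆ Finset.Icc (s.min' hs) (s.max' hs) := fun x hx =>
      Finset.mem_Icc.2 ⟨s.min'_le x hx, s.le_max' x hx⟩
    have hcard := Finset.card_le_card hsub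
    rw [Nat.card_Icc] at hcard
    have h1 := h _ (s.min'_mem hs) _ (s.max'_mem hs)
    have h2 : s.min' hs ≤ s.max' hs := s.min'_le _ (s.max'_mem hs)
    have h3 : s.card + s.min' hs ≤ s.max' hs + 1 := by omega
    have h4 : (s.card : ℝ) + (s.min' hs : ℕ) ≤ (s.max' hs : ℕ) + 1 := by exact_mod_cast h3
    linarith

/-- If no two points of a fibre of `g` are more than `c` apart, then each value of `g` is taken at
most `c + 1` times. -/
theorem sum_comp_le_of_gap {s s' : Finset ℕ} {g : ℕ → ℕ} {f : ℕ → ℝ} {c : ℝ} (hc : 0 ≤ c)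
    (hg : ∀ x ∈ s, g x ∈ s') (hf : ∀ m ∈ s', 0 ≤ f m)
    (hgap : ∀ x ∈ s, ∀ y ∈ s, g x = g y → (y : ℝ) - x ≤ c) :
    ∑ x ∈ s, f (g x) ≤ (c + 1) * ∑ m ∈ s', f m := by
  rw [← Finset.sum_fiberwise_of_maps_to hg, Finset.mul_sum]
  refine Finset.sum_le_sum fun m hm => ?_
  have h1 : ∑ x ∈ s with g x = m, f (g x) = ((s.filter fun x => g x = m).card : ℝ) * f m := by
    rw [← nsmul_eq_mul, ← Finset.sum_const]
    refine Finset.sum_congr rfl fun x hx => ?_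
    rw [(Finset.mem_filter.1 hx).2]
  rw [h1]
  refine mul_le_mul_of_nonneg_right (card_le_of_gap _ hc fun x hx y hy => ?_) (hf m hm)
  rw [Finset.mem_filter] at hx hy
  exact hgap x hx.1 y hy.1 (hx.2.trans hy.2.symm)

theorem sub_le_inv_of_floor_eq {ε : ℝ} (hε : 0 < ε) {x y : ℕ}
    (h : ⌊ε * (x : ℝ)⌋₊ = ⌊ε * (y : ℝ)⌋₊) : (y : ℝ) - x ≤ 1 / ε := by
  have h1 := Nat.floor_le (a := ε * (x : ℝ)) (by positivity)
  have h2 := Nat.lt_floor_add_one (ε * (y : ℝ))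
  rw [h] at h1
  rw [le_div_iff₀ hε]
  nlinarith

theorem sub_le_inv_of_ceil_eq {a : ℝ} (ha : 0 < a) {x y : ℕ}
    (h : ⌈a * (x : ℝ)⌉₊ = ⌈a * (y : ℝ)⌉₊) : (y : ℝ) - x ≤ 1 / a := by
  have h1 := Nat.ceil_lt_add_one (a := a * (x : ℝ)) (by positivity)
  have h2 := Nat.le_ceil (a * (y : ℝ))
  rw [h] at h1
  rw [le_div_iff₀ ha]
  nlinarith

/-! ### The sum of the confidence bonuses -/

theorem inv_mul_sqrt_le {n : ℕ} (hn : 1 ≤ n) :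
    1 / ((n : ℝ) * √n) ≤ 6 * (1 / √(n : ℝ) - 1 / √((n + 1 : ℕ) : ℝ)) := by
  have hn' : (1 : ℝ) ≤ n := by exact_mod_cast hn
  set x := √(n : ℝ) with hx
  set y := √((n + 1 : ℕ) : ℝ) with hy
  have hx2 : x ^ 2 = n := Real.sq_sqrt (by positivity)
  have hy2 : y ^ 2 = n + 1 := by
    rw [hy, Real.sq_sqrt (by positivity)]
    push_cast
    ring
  have hx1 : 1 ≤ x := Real.one_le_sqrt.2 hn'
  have hxy : x ≤ y := Real.sqrt_le_sqrt (by push_cast; linarith)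
  have hy0 : 0 < y := by linarith
  have hyx : y ≤ 3 / 2 * x := by nlinarith
  have h1 : 1 / x - 1 / y = 1 / (x * y * (x + y)) := by
    field_simp
    nlinarith
  rw [h1, ← hx2, show 6 * (1 / (x * y * (x + y))) = 6 / (x * y * (x + y)) by ring,
    div_le_div_iff₀ (by positivity) (by positivity)]
  have h2 : y * (x + y) ≤ (3 / 2 * x) * (x + 3 / 2 * x) := by gcongr
  nlinarith [mul_le_mul_of_nonneg_left h2 (by linarith : (0 : ℝ) ≤ x),
    pow_pos (by linarith : 0 < x) 3]

theorem sum_Ico_inv_mul_sqrt_le {m n : ℕ} (hm : 1 ≤ m) :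
    ∑ k ∈ Finset.Ico m n, 1 / ((k : ℝ) * √k) ≤ 6 / √(m : ℝ) := by
  rcases le_total n m with h | h
  · rw [Finset.Ico_eq_empty_of_le h, Finset.sum_empty]
    positivity
  have h1 : ∑ k ∈ Finset.Ico m n, 1 / ((k : ℝ) * √k)
      ≤ ∑ k ∈ Finset.Ico m n, 6 * (-(1 / √((k + 1 : ℕ) : ℝ)) - -(1 / √(k : ℝ))) := by
    refine Finset.sum_le_sum fun k hk => ?_
    have := inv_mul_sqrt_le (hm.trans (Finset.mem_Ico.1 hk).1)
    linarith
  rw [← Finset.mul_sum, Finset.sum_Ico_sub (fun k : ℕ => -(1 / √(k : ℝ))) h] at h1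
  have h2 : 0 ≤ 1 / √(n : ℝ) := by positivity
  have h3 : 6 / √(m : ℝ) = 6 * (1 / √(m : ℝ)) := by ring
  linarith

/-- The truncated confidence width `min (1, Y^{3/2} / w^{3/2})`, and `1` for the empty window. -/
def width (Y : ℝ) (w : ℕ) : ℝ := if w = 0 then 1 else min 1 (Y * √Y / ((w : ℝ) * √w))

theorem width_nonneg {Y : ℝ} (hY : 0 ≤ Y) (w : ℕ) : 0 ≤ width Y w := by
  unfold width
  split_ifs
  · exact zero_le_one
  · exact le_min zero_le_one (by positivity)

theorem width_le_one (Y : ℝ) (w : ℕ) : width Y w ≤ 1 := by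
  unfold width
  split_ifs
  · exact le_rfl
  · exact min_le_left _ _

/-- The widths are summable with a sum of order `Y`: the windows `w ≤ Y` contribute at most `1`
each, the others `Y^{3/2} ∑_{w > Y} w^{-3/2}`. -/
theorem sum_width_le {Y : ℝ} (hY : 0 < Y) (n : ℕ) :
    ∑ w ∈ Finset.range n, width Y w ≤ 1 + 7 * Y := by
  set m := ⌊Y⌋₊ + 1 with hm
  have hmY : Y < m := by
    rw [hm]
    push_cast
    exact Nat.lt_floor_add_one Y
  have hmY' : (m : ℝ) ≤ 1 + Y := by
    rw [hm]
    push_cast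
    linarith [Nat.floor_le hY.le]
  have hsub : Finset.range n ⊆ Finset.range m ∪ Finset.Ico m n := by
    intro k hk
    simp only [Finset.mem_union, Finset.mem_range, Finset.mem_Ico] at hk ⊢
    omega
  have hdisj : Disjoint (Finset.range m) (Finset.Ico m n) := by
    rw [Finset.disjoint_left]
    intro k hk hk'
    simp only [Finset.mem_range, Finset.mem_Ico] at hk hk'
    omega
  refine (Finset.sum_le_sum_of_subset_of_nonneg hsub fun k _ _ => width_nonneg hY.le k).trans ?_
  rw [Finset.sum_union hdisj]
  have h1 : ∑ w ∈ Finset.range m, width Y w ≤ m := by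
    refine (Finset.sum_le_sum fun w _ => width_le_one Y w).trans ?_
    simp
  have h2 : ∑ w ∈ Finset.Ico m n, width Y w ≤ 6 * Y := by
    have h3 : ∑ w ∈ Finset.Ico m n, width Y w
        ≤ ∑ w ∈ Finset.Ico m n, Y * √Y * (1 / ((w : ℝ) * √w)) := by
      refine Finset.sum_le_sum fun w hw => ?_
      have hw0 : w ≠ 0 := by
        have := (Finset.mem_Ico.1 hw).1
        omega
      rw [width, if_neg hw0, mul_one_div]
      exact min_le_right _ _
    rw [← Finset.mul_sum] at h3
    have h4 := sum_Ico_inv_mul_sqrt_le (m := m) (n := n) (by omega)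
    have hYs : 0 < √Y := Real.sqrt_pos.2 hY
    have h5 : 6 / √(m : ℝ) ≤ 6 / √Y := by
      gcongr
    calc _ ≤ Y * √Y * (6 / √Y) := h3.trans (by gcongr; exact h4.trans h5)
      _ = 6 * Y := by field_simp
  linarith

/-- Summed over the pulls of one arm, the widths of the windows `⌊ε N⌋` give a multiple of `Y / ε`,
since each window size occurs at most `1 / ε + 1` times. -/
theorem sum_width_floor_le {ε Y : ℝ} (hε : 0 < ε) (hε1 : ε ≤ 1) (hY : 0 < Y) (n : ℕ) :
    ∑ N ∈ Finset.range n, width Y ⌊ε * (N : ℝ)⌋₊ ≤ 2 / ε * (1 + 7 * Y) := by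
  have h1 : ∑ N ∈ Finset.range n, width Y ⌊ε * (N : ℝ)⌋₊
      ≤ (1 / ε + 1) * ∑ w ∈ Finset.range n, width Y w := by
    refine sum_comp_le_of_gap (g := fun N : ℕ => ⌊ε * (N : ℝ)⌋₊) (by positivity) ?_
      (fun m _ => width_nonneg hY.le m) fun x _ y _ h => sub_le_inv_of_floor_eq hε h
    intro N hN
    rw [Finset.mem_range] at hN ⊢
    refine lt_of_le_of_lt (Nat.floor_le_of_le ?_) hN
    nlinarith [(Nat.cast_nonneg N : (0 : ℝ) ≤ N)]
  refine h1.trans ?_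
  have h2 : 1 / ε + 1 ≤ 2 / ε := by
    rw [div_add_one hε.ne']
    gcongr
    linarith
  exact mul_le_mul h2 (sum_width_le hY n) (Finset.sum_nonneg fun m _ => width_nonneg hY.le m)
    (by positivity)

/-! ### The sum of the biases -/

/-- An antitone sequence summed along `N ↦ ⌈a N⌉` over the pulls of all arms. Below the level `M`
each value occurs at most `1 / a + 1` times per arm; above it, every term is at most the average of
`f` over `1, …, M - 1`. -/
theorem sum_ceil_le {K T : ℕ} {a : ℝ} (ha : 0 < a) (ha1 : a ≤ 1) (hK : 0 < K)
    (hKT : (K : ℝ) < a * T) {f : ℕ → ℝ} (hf0 : ∀ m, 1 ≤ m → 0 ≤ f m)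
    (hf : ∀ m n, 1 ≤ m → m ≤ n → f n ≤ f m) (p : Fin K → ℕ) (hp : ∑ i, p i = T) :
    ∑ i, ∑ N ∈ Finset.range (p i), (if N = 0 then 0 else f ⌈a * (N : ℝ)⌉₊)
      ≤ 4 * K / a * ∑ l ∈ Finset.Ico 1 ⌈a * (T : ℝ) / (K : ℝ)⌉₊, f l := by
  have hK' : (0 : ℝ) < K := by exact_mod_cast hK
  set M := ⌈a * (T : ℝ) / (K : ℝ)⌉₊ with hM
  set U := ∑ l ∈ Finset.Ico 1 M, f l with hU
  have hMge : a * T / K ≤ M := Nat.le_ceil _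
  have hM1 : 1 < M := by
    rw [hM, Nat.lt_ceil, Nat.cast_one, lt_div_iff₀ hK']
    linarith
  have hM2 : (2 : ℝ) ≤ M := by exact_mod_cast hM1
  have hfM : 0 ≤ f (M - 1) := hf0 _ (by omega)
  have hU0 : 0 ≤ U := Finset.sum_nonneg fun l hl => hf0 l (Finset.mem_Ico.1 hl).1
  have havg : ((M : ℝ) - 1) * f (M - 1) ≤ U := by
    have h1 : (Finset.Ico 1 M).card • f (M - 1) ≤ U :=
      Finset.card_nsmul_le_sum _ _ _ fun l hl => by
        rw [Finset.mem_Ico] at hl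
        exact hf l (M - 1) hl.1 (by omega)
    rwa [Nat.card_Ico, nsmul_eq_mul, Nat.cast_sub hM1.le, Nat.cast_one] at h1
  have harm : ∀ n : ℕ, ∑ N ∈ Finset.range n, (if N = 0 then 0 else f ⌈a * (N : ℝ)⌉₊)
      ≤ (1 / a + 1) * U + n * f (M - 1) := by
    intro n
    have hpos : ∀ N : ℕ, N ≠ 0 → 1 ≤ ⌈a * (N : ℝ)⌉₊ := by
      intro N hN
      refine Nat.one_le_ceil_iff.2 ?_
      have : (0 : ℝ) < N := by exact_mod_cast Nat.pos_of_ne_zero hN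
      positivity
    rw [Finset.sum_ite, Finset.sum_const_zero, zero_add,
      ← Finset.sum_filter_add_sum_filter_not _ (fun N : ℕ => ⌈a * (N : ℝ)⌉₊ < M)]
    refine add_le_add ?_ ?_
    · refine sum_comp_le_of_gap (g := fun N : ℕ => ⌈a * (N : ℝ)⌉₊) (by positivity) ?_
        (fun m hm => hf0 m (Finset.mem_Ico.1 hm).1) fun x _ y _ h => sub_le_inv_of_ceil_eq ha h
      intro N hN
      simp only [Finset.mem_filter] at hN
      exact Finset.mem_Ico.2 ⟨hpos N hN.1.2, hN.2⟩
    · refine (Finset.sum_le_card_nsmul _ _ (f (M - 1)) ?_).trans ?_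
      · intro N hN
        simp only [Finset.mem_filter] at hN
        exact hf _ _ (by omega) (by omega)
      · rw [nsmul_eq_mul]
        refine mul_le_mul_of_nonneg_right ?_ hfM
        have h1 := (Finset.card_filter_le (Finset.filter (fun N => ¬N = 0) (Finset.range n))
          (fun N : ℕ => ¬ ⌈a * (N : ℝ)⌉₊ < M)).trans (Finset.card_filter_le _ _)
        rw [Finset.card_range] at h1
        exact_mod_cast h1
  refine (Finset.sum_le_sum fun i _ => harm (p i)).trans ?_
  rw [Finset.sum_add_distrib, Finset.sum_const, Finset.card_univ, Fintype.card_fin, nsmul_eq_mul,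
    ← Finset.sum_mul, ← Nat.cast_sum, hp]
  have h2 : 1 / a + 1 ≤ 2 / a := by
    rw [div_add_one ha.ne']
    gcongr
    linarith
  have h3 : (T : ℝ) * f (M - 1) ≤ 2 * K / a * U := by
    have h4 : (T : ℝ) ≤ 2 * K / a * ((M : ℝ) - 1) := by
      rw [div_le_iff₀ hK'] at hMge
      rw [div_mul_eq_mul_div, le_div_iff₀ ha]
      nlinarith
    calc (T : ℝ) * f (M - 1) ≤ 2 * K / a * ((M : ℝ) - 1) * f (M - 1) := by gcongr
      _ = 2 * K / a * (((M : ℝ) - 1) * f (M - 1)) := by ring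
      _ ≤ 2 * K / a * U := by gcongr
  calc (K : ℝ) * ((1 / a + 1) * U) + T * f (M - 1)
      ≤ K * (2 / a * U) + 2 * K / a * U := by gcongr
    _ = 4 * K / a * U := by ring

/-! ### Rising sequences -/

/-- A sequence which is non-decreasing and concave from the index `1` on. -/
structure IsRising (u : ℕ → ℝ) : Prop where
  incr_nonneg : ∀ n, 1 ≤ n → 0 ≤ u (n + 1) - u n
  incr_succ_le : ∀ n, 1 ≤ n → u (n + 2) - u (n + 1) ≤ u (n + 1) - u n

namespace IsRising

variable {u : ℕ → ℝ}

theorem incr_antitone (hu : IsRising u) {m n : ℕ} (hm : 1 ≤ m) (hmn : m ≤ n) :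
    u (n + 1) - u n ≤ u (m + 1) - u m := by
  induction n, hmn using Nat.le_induction with
  | base => exact le_rfl
  | succ k hk ih => exact (hu.incr_succ_le k (hm.trans hk)).trans ih

theorem mono (hu : IsRising u) {m n : ℕ} (hm : 1 ≤ m) (hmn : m ≤ n) : u m ≤ u n := by
  induction n, hmn using Nat.le_induction with
  | base => exact le_rfl
  | succ k hk ih => linarith [hu.incr_nonneg k (hm.trans hk)]

theorem sub_le (hu : IsRising u) {m : ℕ} (hm : 1 ≤ m) (k : ℕ) :
    u (m + k) - u m ≤ k * (u (m + 1) - u m) := by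
  induction k with
  | zero => simp
  | succ k ih =>
    have h := hu.incr_antitone hm (Nat.le_add_right m k)
    rw [← add_assoc]
    push_cast
    linarith

theorem le_sub (hu : IsRising u) {m : ℕ} (hm : 1 ≤ m) (k : ℕ) :
    k * (u (m + k + 1) - u (m + k)) ≤ u (m + k) - u m := by
  induction k with
  | zero => simp
  | succ k ih =>
    have h := hu.incr_succ_le (m + k) (by omega)
    have h1 : (k : ℝ) * (u (m + k + 2) - u (m + k + 1))
        ≤ k * (u (m + k + 1) - u (m + k)) := by gcongr
    rw [← add_assoc]
    push_cast
    have e : m + k + 1 + 1 = m + k + 2 := rfl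
    rw [e]
    linarith

/-- The linear extrapolation from two earlier values lies above a concave sequence. -/
theorem le_extrapolation (hu : IsRising u) {l w t : ℕ} (hl : w + 1 ≤ l) (hw : 1 ≤ w)
    (hlt : l ≤ t) : u t ≤ u l + ((t : ℝ) - l) * ((u l - u (l - w)) / w) := by
  obtain ⟨m, rfl⟩ := Nat.exists_eq_add_of_le' (show w ≤ l by omega)
  obtain ⟨k, rfl⟩ := Nat.exists_eq_add_of_le hlt
  have hw' : (0 : ℝ) < w := by exact_mod_cast hw
  have h1 := hu.sub_le (m := m + w) (by omega) k
  have h2 := hu.le_sub (m := m) (by omega) w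
  rw [Nat.add_sub_cancel]
  have h3 : u (m + w + 1) - u (m + w) ≤ (u (m + w) - u m) / w := by
    rw [le_div_iff₀ hw']
    linarith
  have h4 : (k : ℝ) * (u (m + w + 1) - u (m + w)) ≤ k * ((u (m + w) - u m) / w) := by gcongr
  push_cast
  rw [show (m : ℝ) + w + k - (m + w) = k by ring]
  linarith

theorem extrapolation_le (hu : IsRising u) {l w t n : ℕ} (hn : 1 ≤ n) (hl : w + n ≤ l)
    (hw : 1 ≤ w) (hlt : l ≤ t) :
    u l + ((t : ℝ) - l) * ((u l - u (l - w)) / w) ≤ u l + t * (u (n + 1) - u n) := by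
  obtain ⟨m, rfl⟩ := Nat.exists_eq_add_of_le' (show w ≤ l by omega)
  have hw' : (0 : ℝ) < w := by exact_mod_cast hw
  have h1 := hu.sub_le (m := m) (by omega) w
  have h2 := hu.incr_antitone hn (show n ≤ m by omega)
  rw [Nat.add_sub_cancel]
  have h3 : (u (m + w) - u m) / w ≤ u (n + 1) - u n := by
    rw [div_le_iff₀ hw']
    nlinarith
  have h4 : ((m + w : ℕ) : ℝ) ≤ t := by exact_mod_cast hlt
  have h5 := hu.incr_nonneg n hn
  have h6 : (0 : ℝ) ≤ ((m + w : ℕ) : ℝ) := Nat.cast_nonneg _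
  have h7 : ((t : ℝ) - ((m + w : ℕ) : ℝ)) * ((u (m + w) - u m) / w)
      ≤ ((t : ℝ) - ((m + w : ℕ) : ℝ)) * (u (n + 1) - u n) :=
    mul_le_mul_of_nonneg_left h3 (by linarith)
  nlinarith

end IsRising

/-! ### Counting pulls along a history -/

variable {K t : ℕ}

/-- The history `h` followed by one more observation. -/
abbrev extend (h : Hist K t) (p : Fin K × ℝ) : Hist K (t + 1) :=
  Fin.snoc (α := fun _ => Fin K × ℝ) h p

theorem exists_eq_extend (h : Hist K (t + 1)) :
    ∃ (h' : Hist K t) (p : Fin K × ℝ), h = extend h' p :=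
  ⟨Fin.init h, h (Fin.last t), (Fin.snoc_init_self h).symm⟩

theorem pulls_extend (h : Hist K t) (p : Fin K × ℝ) (i : Fin K) :
    pulls (extend h p) i = pulls h i + if p.1 = i then 1 else 0 := by
  simp only [pulls, Finset.card_filter, Fin.sum_univ_castSucc, extend, Fin.snoc_castSucc,
    Fin.snoc_last]

theorem pullsUpTo_extend_castSucc (h : Hist K t) (p : Fin K × ℝ) (s : Fin t) (i : Fin K) :
    pullsUpTo (extend h p) s.castSucc i = pullsUpTo h s i := by
  simp only [pullsUpTo, Finset.card_filter, Fin.sum_univ_castSucc, extend, Fin.snoc_castSucc,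
    Fin.snoc_last, Fin.castSucc_le_castSucc_iff]
  rw [if_neg fun h' => absurd (Fin.castSucc_lt_last s) (not_lt.2 h'.1), add_zero]

theorem pullsUpTo_extend_last (h : Hist K t) (p : Fin K × ℝ) (i : Fin K) :
    pullsUpTo (extend h p) (Fin.last t) i = pulls h i + if p.1 = i then 1 else 0 := by
  rw [← pulls_extend]
  simp only [pullsUpTo, pulls, Fin.le_last, true_and]

theorem pullsUpTo_le_pulls (h : Hist K t) (s : Fin t) (i : Fin K) : pullsUpTo h s i ≤ pulls h i :=
  Finset.card_le_card fun s' hs => by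
    simp only [Finset.mem_filter, Finset.mem_univ, true_and] at hs ⊢
    exact hs.2

theorem sum_pulls (h : Hist K t) : ∑ i, pulls h i = t := by
  simp only [pulls]
  rw [← Finset.card_eq_sum_card_fiberwise (fun _ _ => Finset.mem_coe.2 (Finset.mem_univ _)),
    Finset.card_univ, Fintype.card_fin]

theorem pulls_le (h : Hist K t) (i : Fin K) : pulls h i ≤ t :=
  (Finset.single_le_sum (f := fun i => pulls h i) (fun _ _ => Nat.zero_le _)
    (Finset.mem_univ i)).trans (sum_pulls h).le

theorem pullReward_extend_of_le (h : Hist K t) (p : Fin K × ℝ) {i : Fin K} {l : ℕ}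
    (hl : l ≤ pulls h i) : pullReward (extend h p) i l = pullReward h i l := by
  simp only [pullReward, Fin.sum_univ_castSucc, pullsUpTo_extend_castSucc, pullsUpTo_extend_last]
  simp only [extend, Fin.snoc_castSucc, Fin.snoc_last]
  rw [if_neg, add_zero]
  rintro ⟨h1, h2⟩
  rw [if_pos h1] at h2
  omega

theorem pullReward_extend_succ (h : Hist K t) (i : Fin K) (x : ℝ) :
    pullReward (extend h (i, x)) i (pulls h i + 1) = x := by
  simp only [pullReward, Fin.sum_univ_castSucc, pullsUpTo_extend_castSucc, pullsUpTo_extend_last]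
  simp only [extend, Fin.snoc_castSucc, Fin.snoc_last, if_true, and_self]
  rw [Finset.sum_eq_zero, zero_add]
  intro s _
  have := pullsUpTo_le_pulls h s i
  rw [if_neg]
  rintro ⟨-, h2⟩
  omega

theorem measurable_pullsUpTo (s : Fin t) (i : Fin K) :
    Measurable fun h : Hist K t => pullsUpTo h s i := by
  simp only [pullsUpTo, Finset.card_filter]
  refine Finset.measurable_sum _ fun s' _ => ?_
  refine Measurable.ite ?_ measurable_const measurable_const
  exact (MeasurableSet.const _).inter
    ((measurable_fst.comp (measurable_pi_apply s')) (measurableSet_singleton i))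

theorem measurable_pullReward (i : Fin K) (l : ℕ) :
    Measurable fun h : Hist K t => pullReward h i l := by
  refine Finset.measurable_sum _ fun s _ => ?_
  refine Measurable.ite ?_ (measurable_snd.comp (measurable_pi_apply s)) measurable_const
  exact ((measurable_fst.comp (measurable_pi_apply s)) (measurableSet_singleton i)).inter
    ((measurable_pullsUpTo s i) (measurableSet_singleton l))

/-- The sum over all pulls in `h` of a quantity `W i n` which depends on the arm and on the number
`n` of its previous pulls. -/
def pullSum (W : Fin K → ℕ → ℝ) (h : Hist K t) : ℝ := ∑ i, ∑ n ∈ Finset.range (pulls h i), W i n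

theorem pullSum_extend (W : Fin K → ℕ → ℝ) (h : Hist K t) (p : Fin K × ℝ) :
    pullSum W (extend h p) = pullSum W h + W p.1 (pulls h p.1) := by
  have h1 : ∀ i, ∑ n ∈ Finset.range (pulls (extend h p) i), W i n
      = ∑ n ∈ Finset.range (pulls h i), W i n + if p.1 = i then W i (pulls h i) else 0 := by
    intro i
    rw [pulls_extend]
    split_ifs
    · rw [Finset.sum_range_succ]
    · rw [add_zero, add_zero]
  simp only [pullSum, h1, Finset.sum_add_distrib, Finset.sum_ite_eq, Finset.mem_univ, if_true]

theorem measurable_pullSum (W : Fin K → ℕ → ℝ) : Measurable fun h : Hist K t => pullSum W h := by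
  refine Finset.measurable_sum _ fun i _ => ?_
  exact (measurable_from_nat (f := fun n => ∑ n ∈ Finset.range n, W i n)).comp (measurable_pulls i)

theorem abs_pullSum_le (W : Fin K → ℕ → ℝ) (h : Hist K t) :
    |pullSum W h| ≤ ∑ i, ∑ n ∈ Finset.range t, |W i n| := by
  refine (Finset.abs_sum_le_sum_abs _ _).trans (Finset.sum_le_sum fun i _ => ?_)
  refine (Finset.abs_sum_le_sum_abs _ _).trans ?_
  exact Finset.sum_le_sum_of_subset_of_nonneg (Finset.range_mono (pulls_le h i))
    fun n _ _ => abs_nonneg _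

theorem integrable_pullSum (W : Fin K → ℕ → ℝ) (μ : Measure (Hist K t)) [IsFiniteMeasure μ] :
    Integrable (fun h => pullSum W h) μ :=
  Integrable.of_bound (measurable_pullSum W).aestronglyMeasurable _
    (Filter.Eventually.of_forall fun h => abs_pullSum_le W h)

theorem sum_payoff_eq_pullSum {ν : MAB K} (hν : ν.IsRested) : ∀ {t : ℕ} (h : Hist K t),
    ∑ s : Fin t, ν.payoff (h s).1 (s + 1) (pullsUpTo h s (h s).1)
      = pullSum (fun i n => ν.restedPayoff i (n + 1)) h
  | 0, h => by simp [pullSum, pulls]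
  | t + 1, h => by
    obtain ⟨h, p, rfl⟩ := exists_eq_extend h
    rw [pullSum_extend, ← sum_payoff_eq_pullSum hν h, Fin.sum_univ_castSucc]
    simp only [pullsUpTo_extend_castSucc, pullsUpTo_extend_last]
    simp only [extend, Fin.snoc_castSucc, Fin.snoc_last, if_true, Fin.val_castSucc, Fin.val_last]
    rw [hν p.1 (t + 1) 1 _ (by omega) le_rfl (by omega)]
    rfl

theorem measurable_apply_act_pulls (π : Policy K) (W : Fin K → ℕ → ℝ) :
    Measurable fun h : Hist K t => W (π.act t h) (pulls h (π.act t h)) := by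
  have h1 : Measurable fun h : Hist K t => (π.act t h, fun i => pulls h i) :=
    (π.measurable_act t).prodMk (measurable_pi_lambda _ fun i => measurable_pulls i)
  exact (measurable_of_countable fun p : Fin K × (Fin K → ℕ) => W p.1 (p.2 p.1)).comp h1

theorem integrable_apply_act_pulls (π : Policy K) (W : Fin K → ℕ → ℝ) (μ : Measure (Hist K t))
    [IsFiniteMeasure μ] : Integrable (fun h => W (π.act t h) (pulls h (π.act t h))) μ := by
  refine Integrable.of_bound (measurable_apply_act_pulls π W).aestronglyMeasurable
    (∑ i, ∑ n ∈ Finset.range (t + 1), |W i n|) (Filter.Eventually.of_forall fun h => ?_)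
  have h1 := Finset.single_le_sum (f := fun n => |W (π.act t h) n|) (fun n _ => abs_nonneg _)
    (Finset.mem_range.2 (Nat.lt_succ_of_le (pulls_le h (π.act t h))))
  exact h1.trans (Finset.single_le_sum (f := fun i => ∑ n ∈ Finset.range (t + 1), |W i n|)
    (fun i _ => Finset.sum_nonneg fun n _ => abs_nonneg _) (Finset.mem_univ (π.act t h)))

/-! ### Integration along one round -/

theorem lintegral_histLaw_succ (ν : MAB K) (π : Policy K) (t : ℕ)
    {G : Hist K (t + 1) → ENNReal} (hG : Measurable G) :
    ∫⁻ h, G h ∂(histLaw ν π (t + 1))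
      = ∫⁻ h, ∫⁻ x, G (extend h (π.act t h, x))
          ∂(ν.law (π.act t h) (t + 1) (pulls h (π.act t h) + 1)) ∂(histLaw ν π t) := by
  rw [histLaw, lintegral_map hG (measurable_snoc π t)]
  exact Measure.lintegral_compProd (hG.comp (measurable_snoc π t))

theorem integral_pullSum_succ (ν : MAB K) (π : Policy K) (t : ℕ) (W : Fin K → ℕ → ℝ) :
    ∫ h, pullSum W h ∂(histLaw ν π (t + 1))
      = ∫ h, (pullSum W h + W (π.act t h) (pulls h (π.act t h))) ∂(histLaw ν π t) := by
  have hm : Measurable fun h : Hist K t => pullSum W h + W (π.act t h) (pulls h (π.act t h)) :=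
    (measurable_pullSum W).add (measurable_apply_act_pulls π W)
  conv_rhs => rw [← Measure.fst_compProd (histLaw ν π t) (rewardKernel ν π t)]
  rw [histLaw, integral_map (measurable_snoc π t).aemeasurable
    (measurable_pullSum W).aestronglyMeasurable, Measure.fst,
    integral_map measurable_fst.aemeasurable hm.aestronglyMeasurable]
  refine integral_congr_ae (Filter.Eventually.of_forall fun p => ?_)
  exact pullSum_extend W p.1 (π.act t p.1, p.2)

/-! ### Concentration of the rewards -/

/-- The exponent of the supermartingale of the rewards of arm `i`: the weighted sum of the centred
rewards, compensated by the variance proxies. -/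
def compensatedSum (u c : ℕ → ℝ) (s : ℝ) (i : Fin K) (h : Hist K t) : ℝ :=
  ∑ j ∈ Finset.range (pulls h i),
    (c (j + 1) * (pullReward h i (j + 1) - u (j + 1)) - s * c (j + 1) ^ 2 / 2)

theorem compensatedSum_extend_of_ne (u c : ℕ → ℝ) (s : ℝ) {i : Fin K} (h : Hist K t)
    {p : Fin K × ℝ} (hp : p.1 ≠ i) :
    compensatedSum u c s i (extend h p) = compensatedSum u c s i h := by
  rw [compensatedSum, pulls_extend, if_neg hp, add_zero]
  refine Finset.sum_congr rfl fun j hj => ?_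
  rw [pullReward_extend_of_le h p (Finset.mem_range.1 hj)]

theorem compensatedSum_extend (u c : ℕ → ℝ) (s : ℝ) (i : Fin K) (h : Hist K t) (x : ℝ) :
    compensatedSum u c s i (extend h (i, x)) = compensatedSum u c s i h
      + (c (pulls h i + 1) * (x - u (pulls h i + 1)) - s * c (pulls h i + 1) ^ 2 / 2) := by
  rw [compensatedSum, pulls_extend, if_pos rfl, Finset.sum_range_succ, pullReward_extend_succ]
  congr 1
  refine Finset.sum_congr rfl fun j hj => ?_
  rw [pullReward_extend_of_le h _ (Finset.mem_range.1 hj)]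

theorem measurable_sum_range_pulls (i : Fin K) {G : ℕ → Hist K t → ℝ}
    (hG : ∀ j, Measurable (G j)) :
    Measurable fun h : Hist K t => ∑ j ∈ Finset.range (pulls h i), G j h := by
  have h2 : Measurable fun p : ℕ × Hist K t => ∑ j ∈ Finset.range p.1, G j p.2 :=
    measurable_from_prod_countable_right fun n =>
      Finset.measurable_sum (f := G) (Finset.range n) fun j _ => hG j
  exact h2.comp ((measurable_pulls i).prodMk measurable_id)

theorem measurable_compensatedSum (u c : ℕ → ℝ) (s : ℝ) (i : Fin K) :
    Measurable fun h : Hist K t => compensatedSum u c s i h := by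
  unfold compensatedSum
  refine measurable_sum_range_pulls (G := fun j h => c (j + 1) * (pullReward h i (j + 1) - u (j + 1))
    - s * c (j + 1) ^ 2 / 2) i fun j => ?_
  exact (((measurable_pullReward i (j + 1)).sub_const _).const_mul _).sub_const _

theorem lintegral_exp_le_one {μ : Measure ℝ} {m σ : ℝ}
    (h : HasSubgaussianMGF (fun x => x - m) (Real.toNNReal (σ ^ 2)) μ) (a : ℝ) :
    ∫⁻ x, ENNReal.ofReal (Real.exp (a * (x - m) - σ ^ 2 * a ^ 2 / 2)) ∂μ ≤ 1 := by
  have h1 := h.mgf_le a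
  have h2 := h.integrable_exp_mul a
  rw [Real.coe_toNNReal _ (sq_nonneg σ)] at h1
  simp only [Real.exp_sub, div_eq_mul_inv]
  rw [← ofReal_integral_eq_lintegral_ofReal (h2.mul_const _)
    (Filter.Eventually.of_forall fun x => by positivity), integral_mul_const,
    ENNReal.ofReal_le_one, ← div_eq_mul_inv, div_le_one (Real.exp_pos _), ← div_eq_mul_inv]
  exact h1

/-- The exponential supermartingale inequality. The rewards of one arm are not independent, as
their laws may depend on the rounds at which the arm is pulled; but in every round the pulled arm
and its number of pulls, hence the weight, are determined by the past. -/
theorem lintegral_exp_compensatedSum_le {ν : MAB K} {σ : ℝ} (hr : ν.IsRested)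
    (hs : ν.IsSubgaussian σ) (π : Policy K) (i : Fin K) (c : ℕ → ℝ) (t : ℕ) :
    ∫⁻ h, ENNReal.ofReal (Real.exp (compensatedSum (ν.restedPayoff i) c (σ ^ 2) i h))
      ∂(histLaw ν π t) ≤ 1 := by
  induction t with
  | zero =>
    have h0 : ∀ h : Hist K 0, compensatedSum (ν.restedPayoff i) c (σ ^ 2) i h = 0 := by
      intro h
      simp [compensatedSum, pulls]
    simp [h0]
  | succ t ih =>
    rw [lintegral_histLaw_succ ν π t
      (measurable_compensatedSum _ _ _ _).exp.ennreal_ofReal]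
    refine (lintegral_mono fun h => ?_).trans ih
    by_cases hi : π.act t h = i
    · rw [hi]
      simp only [compensatedSum_extend, Real.exp_add, ENNReal.ofReal_mul (Real.exp_pos _).le]
      rw [lintegral_const_mul' _ _ ENNReal.ofReal_ne_top]
      refine mul_le_of_le_one_right' ?_
      have h1 := hs i (t + 1) (pulls h i + 1) (by omega) (by omega)
      rw [hr i (t + 1) 1 _ (by omega) le_rfl (by omega)] at h1
      exact lintegral_exp_le_one h1 _
    · have := ν.isProb (π.act t h) (t + 1) (pulls h (π.act t h) + 1)
      simp only [compensatedSum_extend_of_ne _ _ _ h (p := (π.act t h, _)) hi, lintegral_const,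
        measure_univ, mul_one, le_refl]

/-- Chernoff's bound for a weighted sum of the first `N` rewards of arm `i`, on the event that the
arm has been pulled exactly `N` times. -/
theorem measure_noise_ge_le {ν : MAB K} {σ : ℝ} (hσ : 0 < σ) (hr : ν.IsRested)
    (hs : ν.IsSubgaussian σ) (π : Policy K) (i : Fin K) (c : ℕ → ℝ) (t N : ℕ) {V b : ℝ}
    (hV : 0 < V) (hcV : ∑ j ∈ Finset.range N, c (j + 1) ^ 2 ≤ V) (hb : 0 ≤ b) :
    histLaw ν π t {h | pulls h i = N ∧ b ≤ ∑ j ∈ Finset.range N,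
      c (j + 1) * (pullReward h i (j + 1) - ν.restedPayoff i (j + 1))}
      ≤ ENNReal.ofReal (Real.exp (-(b ^ 2 / (2 * σ ^ 2 * V)))) := by
  -- the minimiser of `a ↦ -a b + σ² a² V / 2`
  set a := b / (σ ^ 2 * V) with ha
  have ha0 : 0 ≤ a := by positivity
  set G : Hist K t → ENNReal := fun h => ENNReal.ofReal
    (Real.exp (compensatedSum (ν.restedPayoff i) (fun l => a * c l) (σ ^ 2) i h)) with hG
  have hGm : Measurable G := (measurable_compensatedSum _ _ _ _).exp.ennreal_ofReal
  set B := b ^ 2 / (2 * σ ^ 2 * V) with hB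
  have hsub : {h : Hist K t | pulls h i = N ∧ b ≤ ∑ j ∈ Finset.range N,
      c (j + 1) * (pullReward h i (j + 1) - ν.restedPayoff i (j + 1))}
      ⊆ {h | ENNReal.ofReal (Real.exp B) ≤ G h} := by
    rintro h ⟨hN, hbh⟩
    refine ENNReal.ofReal_le_ofReal (Real.exp_le_exp.2 ?_)
    have h1 : compensatedSum (ν.restedPayoff i) (fun l => a * c l) (σ ^ 2) i h
        = a * (∑ j ∈ Finset.range N,
            c (j + 1) * (pullReward h i (j + 1) - ν.restedPayoff i (j + 1)))
          - σ ^ 2 * a ^ 2 / 2 * ∑ j ∈ Finset.range N, c (j + 1) ^ 2 := by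
      rw [compensatedSum, hN, Finset.mul_sum, Finset.mul_sum, ← Finset.sum_sub_distrib]
      refine Finset.sum_congr rfl fun j _ => ?_
      ring
    rw [h1]
    have h2 : B = a * b - σ ^ 2 * a ^ 2 / 2 * V := by
      rw [hB, ha]
      field_simp
      ring
    rw [h2]
    gcongr
  refine (measure_mono hsub).trans ?_
  refine (meas_ge_le_lintegral_div hGm.aemeasurable
    (ENNReal.ofReal_pos.2 (Real.exp_pos B)).ne' ENNReal.ofReal_ne_top).trans ?_
  rw [Real.exp_neg, ENNReal.ofReal_inv_of_pos (Real.exp_pos B), ← one_div]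
  gcongr
  exact lintegral_exp_compensatedSum_le hr hs π i _ t

/-! ### The extrapolated window average -/

/-- The average over the last `w` of `N` values of their linear extrapolations to the time `t`,
with slopes taken across `w` steps. -/
def extrap (r : ℕ → ℝ) (N w t : ℕ) : ℝ :=
  1 / (w : ℝ) * ∑ l ∈ Finset.Icc (N - w + 1) N, (r l + ((t : ℝ) - l) * ((r l - r (l - w)) / w))

theorem extrap_sub (r u : ℕ → ℝ) (N w t : ℕ) :
    extrap r N w t - extrap u N w t = extrap (fun l => r l - u l) N w t := by
  rw [extrap, extrap, extrap, ← mul_sub, ← Finset.sum_sub_distrib]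
  congr 1
  refine Finset.sum_congr rfl fun l _ => ?_
  ring

/-- The weight of the `l`-th value in `extrap r (m + w + w) w t`. -/
def extrapWeight (m w t l : ℕ) : ℝ :=
  if l ≤ m then 0
  else if l ≤ m + w then -(((t : ℝ) - (l + w)) / w ^ 2)
  else (w + ((t : ℝ) - l)) / w ^ 2

theorem sum_Icc_eq_sum_range (f : ℕ → ℝ) (m w : ℕ) :
    ∑ l ∈ Finset.Icc (m + 1) (m + w), f l = ∑ k ∈ Finset.range w, f (m + k + 1) := by
  have h1 : Finset.Icc (m + 1) (m + w) = Finset.Ico (m + 1) (m + w + 1) := by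
    ext l
    simp only [Finset.mem_Icc, Finset.mem_Ico]
    omega
  rw [h1, Finset.sum_Ico_eq_sum_range, show m + w + 1 - (m + 1) = w by omega]
  refine Finset.sum_congr rfl fun k _ => ?_
  congr 1
  omega

theorem extrap_eq_sum (r : ℕ → ℝ) (m t : ℕ) {w : ℕ} (hw : 1 ≤ w) :
    extrap r (m + w + w) w t
      = ∑ j ∈ Finset.range (m + w + w), extrapWeight m w t (j + 1) * r (j + 1) := by
  have hw' : (w : ℝ) ≠ 0 := by
    have : (0 : ℝ) < w := by exact_mod_cast hw
    exact this.ne'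
  rw [extrap, Nat.add_sub_cancel, sum_Icc_eq_sum_range, Finset.sum_range_add, Finset.sum_range_add,
    Finset.sum_eq_zero (s := Finset.range m), zero_add, ← Finset.sum_add_distrib, Finset.mul_sum]
  · refine Finset.sum_congr rfl fun k hk => ?_
    rw [Finset.mem_range] at hk
    have e1 : extrapWeight m w t (m + k + 1)
        = -(((t : ℝ) - ((m + k + 1 : ℕ) + w)) / w ^ 2) := by
      rw [extrapWeight, if_neg (by omega), if_pos (by omega)]
    have e2 : extrapWeight m w t (m + w + k + 1)
        = (w + ((t : ℝ) - (m + w + k + 1 : ℕ))) / w ^ 2 := by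
      rw [extrapWeight, if_neg (by omega), if_neg (by omega)]
    rw [e1, e2, show m + w + k + 1 - w = m + k + 1 by omega]
    push_cast
    field_simp
    ring
  · intro j hj
    rw [Finset.mem_range] at hj
    rw [extrapWeight, if_pos (by omega), zero_mul]

theorem sum_extrapWeight_sq_le {m w t : ℕ} (hw : 1 ≤ w) (ht : m + w + w + 1 ≤ t) :
    ∑ j ∈ Finset.range (m + w + w), extrapWeight m w t (j + 1) ^ 2
      ≤ 5 * ((t : ℝ) - (m + w + w : ℕ) + w - 1) ^ 2 / w ^ 3 := by
  have hw' : (0 : ℝ) < w := by exact_mod_cast hw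
  set A := (t : ℝ) - (m + w + w : ℕ) + w - 1 with hA
  have ht' : ((m + w + w : ℕ) : ℝ) + 1 ≤ t := by exact_mod_cast ht
  have hwA : (w : ℝ) ≤ A := by linarith
  rw [Finset.sum_range_add, Finset.sum_range_add, Finset.sum_eq_zero (s := Finset.range m),
    zero_add, ← Finset.sum_add_distrib]
  · have h1 : ∀ k ∈ Finset.range w, extrapWeight m w t (m + k + 1) ^ 2
        + extrapWeight m w t (m + w + k + 1) ^ 2 ≤ 5 * A ^ 2 / w ^ 4 := by
      intro k hk
      rw [Finset.mem_range] at hk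
      have hk' : (k : ℝ) + 1 ≤ w := by exact_mod_cast hk
      have hk0 : (0 : ℝ) ≤ k := Nat.cast_nonneg k
      rw [extrapWeight, if_neg (by omega), if_pos (by omega), extrapWeight, if_neg (by omega),
        if_neg (by omega)]
      push_cast at hA ht' ⊢
      set x := (t : ℝ) - (m + w + k + 1) with hx
      have hx0 : 0 ≤ x := by linarith
      have hxA : x ≤ A := by linarith
      have e1 : (t : ℝ) - (m + k + 1 + w) = x := by rw [hx]; ring
      rw [e1, neg_sq, div_pow, div_pow, ← add_div, ← pow_mul]
      gcongr
      nlinarith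
    refine (Finset.sum_le_card_nsmul _ _ _ h1).trans (le_of_eq ?_)
    rw [Finset.card_range, nsmul_eq_mul]
    field_simp
  · intro j hj
    rw [Finset.mem_range] at hj
    rw [extrapWeight, if_pos (by omega)]
    norm_num

theorem IsRising.le_extrap {u : ℕ → ℝ} (hu : IsRising u) {N w t : ℕ} (hw : 1 ≤ w)
    (hwN : 2 * w ≤ N) (hNt : N ≤ t) : u t ≤ extrap u N w t := by
  have hw' : (0 : ℝ) < w := by exact_mod_cast hw
  have h1 := Finset.card_nsmul_le_sum (Finset.Icc (N - w + 1) N)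
    (fun l => u l + ((t : ℝ) - l) * ((u l - u (l - w)) / w)) (u t) fun l hl => by
      rw [Finset.mem_Icc] at hl
      exact hu.le_extrapolation (by omega) hw (by omega)
  rw [Nat.card_Icc, show N + 1 - (N - w + 1) = w by omega, nsmul_eq_mul] at h1
  rw [extrap, one_div, ← div_eq_inv_mul, le_div_iff₀ hw']
  linarith

theorem IsRising.extrap_le {u : ℕ → ℝ} (hu : IsRising u) {N w t : ℕ} (hw : 1 ≤ w)
    (hwN : 2 * w ≤ N) (hNt : N ≤ t) :
    extrap u N w t ≤ u (N + 1) + t * (u (N - 2 * w + 1 + 1) - u (N - 2 * w + 1)) := by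
  have hw' : (0 : ℝ) < w := by exact_mod_cast hw
  have h1 := Finset.sum_le_card_nsmul (Finset.Icc (N - w + 1) N)
    (fun l => u l + ((t : ℝ) - l) * ((u l - u (l - w)) / w))
    (u (N + 1) + t * (u (N - 2 * w + 1 + 1) - u (N - 2 * w + 1))) fun l hl => by
      rw [Finset.mem_Icc] at hl
      have h2 := hu.extrapolation_le (n := N - 2 * w + 1) (l := l) (w := w) (t := t) (by omega)
        (by omega) hw (by omega)
      have h3 := hu.mono (m := l) (n := N + 1) (by omega) (by omega)
      linarith
  rw [Nat.card_Icc, show N + 1 - (N - w + 1) = w by omega, nsmul_eq_mul] at h1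
  rw [extrap, one_div, ← div_eq_inv_mul, div_le_iff₀ hw']
  linarith

/-! ### The good event -/

/-- The width of the confidence interval at round `t` for an arm with `N` pulls and window `w`. -/
def radius (σ α : ℝ) (N w t : ℕ) : ℝ :=
  σ * ((t : ℝ) - N + w - 1) * √(10 * Real.log (1 / (t : ℝ) ^ (-α)) / (w : ℝ) ^ 3)

/-- After the history `h`, the estimator of every arm with a non-empty window is within the
confidence width of its mean. -/
def Concentrated (ν : MAB K) (σ ε α : ℝ) (h : Hist K t) : Prop :=
  ∀ i, 1 ≤ ⌊ε * (pulls h i : ℝ)⌋₊ →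
    |extrap (pullReward h i) (pulls h i) ⌊ε * (pulls h i : ℝ)⌋₊ (t + 1)
      - extrap (ν.restedPayoff i) (pulls h i) ⌊ε * (pulls h i : ℝ)⌋₊ (t + 1)|
      ≤ radius σ α (pulls h i) ⌊ε * (pulls h i : ℝ)⌋₊ (t + 1)

theorem two_mul_floor_le {ε : ℝ} (hε : 0 < ε) (hε2 : ε < 1 / 2) (N : ℕ) :
    2 * ⌊ε * (N : ℝ)⌋₊ ≤ N := by
  have h1 := Nat.floor_le (a := ε * (N : ℝ)) (by positivity)
  have h2 : (0 : ℝ) ≤ N := Nat.cast_nonneg N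
  have h3 : (2 : ℝ) * ⌊ε * (N : ℝ)⌋₊ ≤ N := by nlinarith
  exact_mod_cast h3

theorem log_one_div_rpow_neg (α : ℝ) (t : ℕ) :
    Real.log (1 / ((t + 1 : ℕ) : ℝ) ^ (-α)) = α * Real.log ((t + 1 : ℕ) : ℝ) := by
  have h : (0 : ℝ) < ((t + 1 : ℕ) : ℝ) := by positivity
  rw [one_div, Real.log_inv, Real.log_rpow h]
  ring

/-- For a fixed number of pulls, the estimator of an arm leaves its confidence interval with
probability at most `2 (t + 1) ^ (-α)`. -/
theorem measure_deviation_le {ν : MAB K} {σ α : ℝ} (hσ : 0 < σ) (hα : 0 < α) (hr : ν.IsRested)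
    (hs : ν.IsSubgaussian σ) (π : Policy K) (i : Fin K) {t N w : ℕ} (hw : 1 ≤ w)
    (hwN : 2 * w ≤ N) (hNt : N ≤ t) :
    histLaw ν π t {h | pulls h i = N ∧ radius σ α N w (t + 1)
      < |extrap (pullReward h i) N w (t + 1) - extrap (ν.restedPayoff i) N w (t + 1)|}
      ≤ 2 * ENNReal.ofReal (((t + 1 : ℕ) : ℝ) ^ (-α)) := by
  obtain ⟨m, rfl⟩ : ∃ m, N = m + w + w := ⟨N - 2 * w, by omega⟩
  have hw' : (0 : ℝ) < w := by exact_mod_cast hw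
  have ht' : ((m + w + w : ℕ) : ℝ) ≤ t := by exact_mod_cast hNt
  have hA : 0 < ((t + 1 : ℕ) : ℝ) - (m + w + w : ℕ) + w - 1 := by
    push_cast at ht' ⊢
    linarith
  set A := ((t + 1 : ℕ) : ℝ) - (m + w + w : ℕ) + w - 1 with hAdef
  have hlog : 0 ≤ α * Real.log ((t + 1 : ℕ) : ℝ) :=
    mul_nonneg hα.le (Real.log_natCast_nonneg _)
  set b := radius σ α (m + w + w) w (t + 1) with hb
  have hb0 : 0 ≤ b := by
    rw [hb, radius]
    positivity
  set V := 5 * A ^ 2 / (w : ℝ) ^ 3 with hV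
  have hVpos : 0 < V := by positivity
  have hexp : Real.exp (-(b ^ 2 / (2 * σ ^ 2 * V))) = ((t + 1 : ℕ) : ℝ) ^ (-α) := by
    rw [Real.rpow_def_of_pos (by positivity)]
    congr 1
    have h1 : b ^ 2 = σ ^ 2 * A ^ 2 * (10 * (α * Real.log ((t + 1 : ℕ) : ℝ)) / (w : ℝ) ^ 3) := by
      rw [hb, radius, ← hAdef, log_one_div_rpow_neg, mul_pow, mul_pow,
        Real.sq_sqrt (by positivity)]
    rw [h1, hV]
    field_simp
    ring
  have hW := sum_extrapWeight_sq_le (m := m) (t := t + 1) hw (by omega)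
  rw [← hAdef, ← hV] at hW
  have hup := measure_noise_ge_le hσ hr hs π i (extrapWeight m w (t + 1)) t (m + w + w) hVpos hW hb0
  have hlow := measure_noise_ge_le hσ hr hs π i (fun l => -extrapWeight m w (t + 1) l) t (m + w + w)
    hVpos (by simpa only [neg_sq] using hW) hb0
  rw [hexp] at hup hlow
  rw [two_mul]
  refine (measure_mono ?_).trans ((measure_union_le _ _).trans (add_le_add hup hlow))
  rintro h ⟨hN, hh⟩
  rw [extrap_sub, extrap_eq_sum _ _ _ hw] at hh
  rcases lt_abs.1 hh with h1 | h1
  · exact Or.inl ⟨hN, h1.le⟩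
  · refine Or.inr ⟨hN, h1.le.trans (le_of_eq ?_)⟩
    rw [← Finset.sum_neg_distrib]
    exact Finset.sum_congr rfl fun j _ => (neg_mul _ _).symm

theorem measure_not_concentrated_le {ν : MAB K} {σ ε α : ℝ} (hσ : 0 < σ) (hα : 0 < α)
    (hε : 0 < ε) (hε2 : ε < 1 / 2) (hr : ν.IsRested) (hs : ν.IsSubgaussian σ) (π : Policy K)
    (t : ℕ) : histLaw ν π t {h | ¬ Concentrated ν σ ε α h}
      ≤ ENNReal.ofReal (2 * K * ((t + 1 : ℕ) : ℝ) ^ (1 - α)) := by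
  set S : Fin K → ℕ → Set (Hist K t) := fun i N => {h | pulls h i = N ∧ 1 ≤ ⌊ε * (N : ℝ)⌋₊ ∧
    radius σ α N ⌊ε * (N : ℝ)⌋₊ (t + 1) < |extrap (pullReward h i) N ⌊ε * (N : ℝ)⌋₊ (t + 1)
      - extrap (ν.restedPayoff i) N ⌊ε * (N : ℝ)⌋₊ (t + 1)|} with hS
  have hsub : {h | ¬ Concentrated ν σ ε α h} ⊆ ⋃ i, ⋃ N ∈ Finset.range (t + 1), S i N := by
    intro h hh
    simp only [Set.mem_ofPred_eq, Concentrated, not_forall, not_le] at hh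
    obtain ⟨i, hi, hi'⟩ := hh
    simp only [Set.mem_iUnion]
    exact ⟨i, pulls h i, Finset.mem_range.2 (Nat.lt_succ_of_le (pulls_le h i)), rfl, hi, hi'⟩
  have hSle : ∀ i, ∀ N ∈ Finset.range (t + 1),
      histLaw ν π t (S i N) ≤ 2 * ENNReal.ofReal (((t + 1 : ℕ) : ℝ) ^ (-α)) := by
    intro i N hN
    rw [Finset.mem_range] at hN
    by_cases hw : 1 ≤ ⌊ε * (N : ℝ)⌋₊
    · refine (measure_mono ?_).trans (measure_deviation_le hσ hα hr hs π i hw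
        (two_mul_floor_le hε hε2 N) (by omega : N ≤ t))
      exact fun h hh => ⟨hh.1, hh.2.2⟩
    · have : S i N = ∅ := Set.eq_empty_of_forall_notMem fun h hh => hw hh.2.1
      rw [this, measure_empty]
      exact zero_le
  refine (measure_mono hsub).trans ((measure_iUnion_fintype_le _ _).trans ?_)
  refine (Finset.sum_le_sum fun i _ => (measure_biUnion_finset_le _ _).trans
    (Finset.sum_le_card_nsmul _ _ _ (hSle i))).trans (le_of_eq ?_)
  have h2 : ((t + 1 : ℕ) : ℝ) ^ (1 - α) = ((t + 1 : ℕ) : ℝ) * ((t + 1 : ℕ) : ℝ) ^ (-α) := by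
    rw [sub_eq_add_neg, Real.rpow_add (by positivity), Real.rpow_one]
  rw [Finset.sum_const, Finset.card_univ, Fintype.card_fin, Finset.card_range, nsmul_eq_mul,
    nsmul_eq_mul, h2, show 2 * (K : ℝ) * (((t + 1 : ℕ) : ℝ) * ((t + 1 : ℕ) : ℝ) ^ (-α))
      = (K : ℝ) * (((t + 1 : ℕ) : ℝ) * (2 * ((t + 1 : ℕ) : ℝ) ^ (-α))) by ring,
    ENNReal.ofReal_mul (by positivity), ENNReal.ofReal_mul (by positivity),
    ENNReal.ofReal_mul (by positivity), ENNReal.ofReal_natCast, ENNReal.ofReal_natCast,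
    ENNReal.ofReal_ofNat]

/-! ### The regret of one round -/

theorem MAB.IsRisingRested.isRising {ν : MAB K} (hν : ν.IsRisingRested) (i : Fin K) :
    IsRising (ν.restedPayoff i) where
  incr_nonneg n hn := hν.nonDecreasing i n hn
  incr_succ_le n hn := by
    have := hν.concave i n hn
    simp only [MAB.incr] at this
    linarith

/-- The largest `q`-th power of an increment, the summand of `cumIncr`. -/
def maxIncr (ν : MAB K) (q : ℝ) (n : ℕ) : ℝ := ⨆ i : Fin K, ν.incr i n ^ q

theorem incr_rpow_le_maxIncr (ν : MAB K) (q : ℝ) (i : Fin K) (n : ℕ) :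
    ν.incr i n ^ q ≤ maxIncr ν q n :=
  le_ciSup (f := fun i => ν.incr i n ^ q) (Set.finite_range _).bddAbove i

theorem maxIncr_nonneg {ν : MAB K} (hν : ν.IsRisingRested) (q : ℝ) {n : ℕ} (hn : 1 ≤ n) :
    0 ≤ maxIncr ν q n :=
  Real.iSup_nonneg fun i => Real.rpow_nonneg (hν.nonDecreasing i n hn) q

theorem maxIncr_antitone (hK : 0 < K) {ν : MAB K} (hν : ν.IsRisingRested) {q : ℝ} (hq : 0 ≤ q)
    {m n : ℕ} (hm : 1 ≤ m) (hmn : m ≤ n) : maxIncr ν q n ≤ maxIncr ν q m := by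
  have : Nonempty (Fin K) := ⟨⟨0, hK⟩⟩
  refine ciSup_le fun i => le_trans ?_ (incr_rpow_le_maxIncr ν q i m)
  exact Real.rpow_le_rpow (hν.nonDecreasing i n (hm.trans hmn))
    ((hν.isRising i).incr_antitone hm hmn) hq

/-- A bound on the regret of a round at which the pulled arm has been pulled `N` times before:
the truncated confidence width plus the bias of the estimator. -/
def roundBound (ν : MAB K) (ε q Y : ℝ) (T N : ℕ) : ℝ :=
  width Y ⌊ε * (N : ℝ)⌋₊
    + (T : ℝ) ^ q * if N = 0 then 0 else maxIncr ν q ⌈(1 - 2 * ε) * (N : ℝ)⌉₊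

theorem one_le_ceil_mul {a : ℝ} (ha : 0 < a) {N : ℕ} (hN : N ≠ 0) : 1 ≤ ⌈a * (N : ℝ)⌉₊ := by
  have : (0 : ℝ) < N := by exact_mod_cast Nat.pos_of_ne_zero hN
  exact Nat.one_le_ceil_iff.2 (by positivity)

theorem roundBound_nonneg {ν : MAB K} (hν : ν.IsRisingRested) {ε q Y : ℝ} (hε2 : ε < 1 / 2)
    (hY : 0 ≤ Y) (T N : ℕ) : 0 ≤ roundBound ν ε q Y T N := by
  refine add_nonneg (width_nonneg hY _) (mul_nonneg (by positivity) ?_)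
  split_ifs with hN
  · exact le_rfl
  · exact maxIncr_nonneg hν q (one_le_ceil_mul (by linarith) hN)

theorem estimator_eq {h : Hist K t} {i : Fin K} {w : ℕ} (hw : 1 ≤ w) (hw2 : 2 * w ≤ pulls h i) :
    estimator h i w = (extrap (pullReward h i) (pulls h i) w (t + 1) : EReal) := by
  rw [estimator, if_pos ⟨hw, by omega⟩]
  rfl

theorem bonus_eq {σ α : ℝ} {h : Hist K t} {i : Fin K} {w : ℕ} (hw : 1 ≤ w) :
    bonus σ h i w (((t + 1 : ℕ) : ℝ) ^ (-α)) = (radius σ α (pulls h i) w (t + 1) : EReal) := by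
  rw [bonus, if_neg (by omega)]
  rfl

theorem index_eq {σ ε α : ℝ} (hε : 0 < ε) (hε2 : ε < 1 / 2) {h : Hist K t} {i : Fin K}
    (hw : 1 ≤ ⌊ε * (pulls h i : ℝ)⌋₊) :
    index σ ε α h i = ((extrap (pullReward h i) (pulls h i) ⌊ε * (pulls h i : ℝ)⌋₊ (t + 1)
      + radius σ α (pulls h i) ⌊ε * (pulls h i : ℝ)⌋₊ (t + 1) : ℝ) : EReal) := by
  rw [index, estimator_eq hw (two_mul_floor_le hε hε2 _), bonus_eq hw, EReal.coe_add]

theorem index_eq_top {σ ε α : ℝ} {h : Hist K t} {i : Fin K}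
    (hw : ¬ 1 ≤ ⌊ε * (pulls h i : ℝ)⌋₊) : index σ ε α h i = ⊤ := by
  rw [index, estimator, if_neg fun h' => hw h'.1, bonus, if_pos (by omega), EReal.top_add_top]

theorem radius_le {σ α : ℝ} (hσ : 0 < σ) (hα : 0 < α) {N w t T : ℕ} (hw : 1 ≤ w)
    (hwN : 2 * w ≤ N) (hNt : N ≤ t) (htT : t + 1 ≤ T) :
    radius σ α N w (t + 1) ≤ σ * T * √(10 * (α * Real.log T)) / ((w : ℝ) * √w) := by
  have hw' : (0 : ℝ) < w := by exact_mod_cast hw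
  have hNt' : (N : ℝ) ≤ t := by exact_mod_cast hNt
  have htT' : ((t + 1 : ℕ) : ℝ) ≤ T := by exact_mod_cast htT
  have hwN' : (w : ℝ) ≤ N := by exact_mod_cast (by omega : w ≤ N)
  have ht0 : (0 : ℝ) < ((t + 1 : ℕ) : ℝ) := by positivity
  have hcube : √((w : ℝ) ^ 3) = w * √w := by
    rw [show (w : ℝ) ^ 3 = w ^ 2 * w by ring, Real.sqrt_mul (by positivity),
      Real.sqrt_sq hw'.le]
  rw [radius, log_one_div_rpow_neg, Real.sqrt_div' _ (by positivity), hcube, ← mul_div_assoc]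
  have h1 : ((t + 1 : ℕ) : ℝ) - N + w - 1 ≤ T := by linarith
  gcongr

/-- On the good event the regret of a round is at most `roundBound`: the index of the pulled arm
exceeds the index of every arm `i`, hence, by concavity, the payoff of `i` at the current round. -/
theorem payoff_le_of_concentrated {ν : MAB K} {σ ε α q Y : ℝ} (hσ : 0 < σ) (hα : 0 < α)
    (hε : 0 < ε) (hε2 : ε < 1 / 2) (hν : ν.IsRisingRested) (hb : ν.IsBounded) {π : Policy K}
    (hπ : π.IsREdUCB σ ε α) (hq : 0 ≤ q) (hq1 : q ≤ 1) {T : ℕ}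
    (hY : 2 * (σ * T * √(10 * (α * Real.log T))) ≤ Y * √Y) (htT : t + 1 ≤ T)
    {h : Hist K t} (hh : Concentrated ν σ ε α h) (i : Fin K) :
    ν.restedPayoff i (t + 1) ≤ ν.restedPayoff (π.act t h) (pulls h (π.act t h) + 1)
      + roundBound ν ε q Y T (pulls h (π.act t h)) := by
  set j := π.act t h with hj
  have hi := (hb i 1 (t + 1) le_rfl (by omega)).2
  have hj0 := (hb j 1 (pulls h j + 1) le_rfl (by omega)).1
  change ν.restedPayoff i (t + 1) ≤ 1 at hi
  change 0 ≤ ν.restedPayoff j (pulls h j + 1) at hj0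
  have hNt := pulls_le h j
  have hw2 := two_mul_floor_le hε hε2 (pulls h j)
  have hidx := hπ t h i
  rw [← hj] at hidx
  have hconc := hh j
  set N := pulls h j with hN
  set w := ⌊ε * (N : ℝ)⌋₊ with hw
  have hT0 : (0 : ℝ) ≤ T := Nat.cast_nonneg T
  by_cases hw1 : 1 ≤ w
  swap
  · have h1 : width Y w = 1 := if_pos (by omega)
    have h2 : 0 ≤ (T : ℝ) ^ q * if N = 0 then 0 else maxIncr ν q ⌈(1 - 2 * ε) * (N : ℝ)⌉₊ := by
      refine mul_nonneg (by positivity) ?_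
      split_ifs with h0
      · exact le_rfl
      · exact maxIncr_nonneg hν q (one_le_ceil_mul (by linarith) h0)
    rw [roundBound, ← hw, h1]
    linarith
  have hN0 : N ≠ 0 := by omega
  have hw' : (0 : ℝ) < w := by exact_mod_cast hw1
  -- the index of the pulled arm is finite, hence so is the index of arm `i`
  rw [index_eq hε hε2 (i := j) hw1] at hidx
  have hwi : 1 ≤ ⌊ε * (pulls h i : ℝ)⌋₊ := by
    by_contra hcon
    rw [index_eq_top hcon, top_le_iff] at hidx
    exact EReal.coe_ne_top _ hidx
  rw [index_eq hε hε2 hwi, EReal.coe_le_coe_iff] at hidx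
  have hci := (abs_le.1 (hh i hwi)).1
  have hcj := (abs_le.1 (hconc hw1)).2
  have hei := (hν.isRising i).le_extrap hwi (two_mul_floor_le hε hε2 _)
    ((pulls_le h i).trans (Nat.le_succ t))
  have hej := (hν.isRising j).extrap_le hw1 hw2 (hNt.trans (Nat.le_succ t))
  have hrad := radius_le hσ hα hw1 hw2 hNt htT
  set g := ν.incr j (N - 2 * w + 1) with hg
  change _ ≤ _ + ((t + 1 : ℕ) : ℝ) * g at hej
  have hg0 : 0 ≤ g := hν.nonDecreasing j _ (by omega)
  have htg : ((t + 1 : ℕ) : ℝ) * g ≤ T * g := by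
    have : ((t + 1 : ℕ) : ℝ) ≤ T := by exact_mod_cast htT
    gcongr
  have hmain : ν.restedPayoff i (t + 1) ≤ ν.restedPayoff j (N + 1) + T * g
      + Y * √Y / ((w : ℝ) * √w) := by
    have h1 : 2 * (σ * T * √(10 * (α * Real.log T)) / ((w : ℝ) * √w))
        ≤ Y * √Y / ((w : ℝ) * √w) := by
      rw [← mul_div_assoc]
      gcongr
    linarith
  have hbias : (T * g) ^ q ≤ (T : ℝ) ^ q * maxIncr ν q ⌈(1 - 2 * ε) * (N : ℝ)⌉₊ := by
    rw [Real.mul_rpow hT0 hg0]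
    have hle : ⌈(1 - 2 * ε) * (N : ℝ)⌉₊ ≤ N - 2 * w + 1 := by
      refine Nat.ceil_le.2 ?_
      have h1 := Nat.floor_le (a := ε * (N : ℝ)) (by positivity)
      rw [← hw] at h1
      have h2 : ((N - 2 * w + 1 : ℕ) : ℝ) = N - 2 * w + 1 := by
        rw [Nat.cast_add, Nat.cast_sub hw2]
        push_cast
        ring
      rw [h2]
      linarith
    have h1 := maxIncr_antitone (K := K) j.pos hν hq (one_le_ceil_mul (by linarith) hN0) hle
    have h2 := incr_rpow_le_maxIncr ν q j (N - 2 * w + 1)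
    gcongr
    exact h2.trans h1
  rw [roundBound, ← hw, if_neg hN0, width, if_neg (by omega)]
  have hTg0 : 0 ≤ T * g := by positivity
  -- `min (1, x) ≤ x ^ q`
  rcases le_total (T * g) 1 with h1 | h1
  · have h2 : T * g ≤ (T * g) ^ q := by
      rcases hTg0.eq_or_lt with h0 | h0
      · rw [← h0]
        positivity
      · simpa only [Real.rpow_one] using Real.rpow_le_rpow_of_exponent_ge h0 h1 hq1
    have h3 : ν.restedPayoff i (t + 1) - ν.restedPayoff j (N + 1) - (T * g) ^ q
        ≤ min 1 (Y * √Y / ((w : ℝ) * √w)) :=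
      le_min (by linarith) (by linarith)
    linarith
  · have h2 : 1 ≤ (T * g) ^ q := Real.one_le_rpow h1 hq
    have h3 : 0 ≤ min 1 (Y * √Y / ((w : ℝ) * √w)) := by
      refine le_min zero_le_one (le_trans ?_ (div_le_div_of_nonneg_right hY (by positivity)))
      positivity
    linarith

/-! ### The regret over all rounds -/

theorem expReward_eq {ν : MAB K} (hν : ν.IsRested) (π : Policy K) (T : ℕ) :
    expReward ν π T
      = ∫ h, pullSum (fun i n => ν.restedPayoff i (n + 1)) h ∂(histLaw ν π T) := by
  simp only [expReward, sum_payoff_eq_pullSum hν]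

/-- The averages of a non-decreasing sequence are non-decreasing. -/
theorem IsRising.mul_sum_le {u : ℕ → ℝ} (hu : IsRising u) {n T : ℕ} (hn : n ≤ T) :
    (T : ℝ) * ∑ j ∈ Finset.range n, u (j + 1) ≤ n * ∑ j ∈ Finset.range T, u (j + 1) := by
  obtain ⟨k, rfl⟩ := Nat.exists_eq_add_of_le hn
  have h1 : ∑ j ∈ Finset.range n, u (j + 1) ≤ n * u (n + 1) := by
    refine (Finset.sum_le_card_nsmul _ _ (u (n + 1)) fun j hj => ?_).trans ?_
    · rw [Finset.mem_range] at hj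
      exact hu.mono (by omega) (by omega)
    · simp
  have h2 : k * u (n + 1) ≤ ∑ j ∈ Finset.range k, u (n + j + 1) := by
    refine le_trans ?_ (Finset.card_nsmul_le_sum _ _ (u (n + 1)) fun j _ => ?_)
    · simp
    · exact hu.mono (by omega) (by omega)
  have h3 : (k : ℝ) * ∑ j ∈ Finset.range n, u (j + 1)
      ≤ n * ∑ j ∈ Finset.range k, u (n + j + 1) :=
    calc (k : ℝ) * ∑ j ∈ Finset.range n, u (j + 1) ≤ k * (n * u (n + 1)) := by gcongr
      _ = n * (k * u (n + 1)) := by ring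
      _ ≤ _ := by gcongr
  rw [Finset.sum_range_add]
  push_cast
  linarith

/-- Pulling always the same, best arm is optimal: the cumulative payoff of an arm is convex in the
number of its pulls. -/
theorem expReward_le {ν : MAB K} (hν : ν.IsRisingRested) {T : ℕ} (hT : 0 < T) {i₀ : Fin K}
    (hi₀ : ∀ i, ∑ n ∈ Finset.range T, ν.restedPayoff i (n + 1)
      ≤ ∑ n ∈ Finset.range T, ν.restedPayoff i₀ (n + 1)) (π : Policy K) :
    expReward ν π T ≤ ∑ n ∈ Finset.range T, ν.restedPayoff i₀ (n + 1) := by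
  have hT' : (0 : ℝ) < T := by exact_mod_cast hT
  rw [expReward_eq hν.rested]
  set S := ∑ n ∈ Finset.range T, ν.restedPayoff i₀ (n + 1) with hS
  have hle : ∀ h : Hist K T, pullSum (fun i n => ν.restedPayoff i (n + 1)) h ≤ S := by
    intro h
    refine le_of_mul_le_mul_left ?_ hT'
    rw [pullSum, Finset.mul_sum]
    calc ∑ i, (T : ℝ) * ∑ n ∈ Finset.range (pulls h i), ν.restedPayoff i (n + 1)
        ≤ ∑ i, (pulls h i : ℝ) * S := Finset.sum_le_sum fun i _ =>
          ((hν.isRising i).mul_sum_le (pulls_le h i)).trans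
            (mul_le_mul_of_nonneg_left (hi₀ i) (Nat.cast_nonneg _))
      _ = T * S := by rw [← Finset.sum_mul, ← Nat.cast_sum, sum_pulls]
  calc _ ≤ ∫ _, S ∂(histLaw ν π T) :=
        integral_mono (integrable_pullSum _ _) (integrable_const _) hle
    _ = S := by simp

theorem expReward_nonneg {ν : MAB K} (hν : ν.IsBounded) (π : Policy K) (T : ℕ) :
    0 ≤ expReward ν π T :=
  integral_nonneg fun h => Finset.sum_nonneg fun s _ =>
    (hν _ _ _ (by omega) (Finset.card_pos.2 ⟨s, by simp⟩)).1

/-- The comparison of the payoffs of a fixed arm with those of the policy, round by round. -/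
theorem sum_payoff_le_integral {ν : MAB K} {σ ε α q Y : ℝ} (hσ : 0 < σ) (hα : 0 < α)
    (hε : 0 < ε) (hε2 : ε < 1 / 2) (hν : ν.IsRisingRested) (hb : ν.IsBounded)
    (hs : ν.IsSubgaussian σ) {π : Policy K} (hπ : π.IsREdUCB σ ε α) (hq : 0 ≤ q) (hq1 : q ≤ 1)
    {T : ℕ} (hY0 : 0 ≤ Y) (hY : 2 * (σ * T * √(10 * (α * Real.log T))) ≤ Y * √Y) (i : Fin K)
    {t : ℕ} (ht : t ≤ T) :
    ∑ n ∈ Finset.range t, ν.restedPayoff i (n + 1)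
      ≤ ∫ h, pullSum (fun j n => ν.restedPayoff j (n + 1) + roundBound ν ε q Y T n) h
          ∂(histLaw ν π t)
        + ∑ n ∈ Finset.range t, 2 * K * ((n + 1 : ℕ) : ℝ) ^ (1 - α) := by
  induction t with
  | zero => simp [pullSum, pulls]
  | succ t ih =>
    set W : Fin K → ℕ → ℝ := fun j n => ν.restedPayoff j (n + 1) + roundBound ν ε q Y T n with hW
    set B := toMeasurable (histLaw ν π t) {h | ¬ Concentrated ν σ ε α h} with hB
    have hBm : MeasurableSet B := measurableSet_toMeasurable _ _
    have hBle : (histLaw ν π t).real B ≤ 2 * K * ((t + 1 : ℕ) : ℝ) ^ (1 - α) := by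
      refine ENNReal.toReal_le_of_le_ofReal (by positivity) ?_
      rw [hB, measure_toMeasurable]
      exact measure_not_concentrated_le hσ hα hε hε2 hν.rested hs π t
    have hpt : ∀ h : Hist K t, ν.restedPayoff i (t + 1) - B.indicator (fun _ => (1 : ℝ)) h
        ≤ W (π.act t h) (pulls h (π.act t h)) := by
      intro h
      by_cases hh : Concentrated ν σ ε α h
      · have h1 := payoff_le_of_concentrated hσ hα hε hε2 hν hb hπ hq hq1 hY ht hh i
        have h2 : 0 ≤ B.indicator (fun _ => (1 : ℝ)) h :=
          Set.indicator_nonneg (fun _ _ => zero_le_one) h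
        simp only [hW]
        linarith
      · rw [Set.indicator_of_mem (subset_toMeasurable _ _ hh)]
        have h1 : ν.restedPayoff i (t + 1) ≤ 1 := (hb i 1 (t + 1) le_rfl (by omega)).2
        have h2 : 0 ≤ ν.restedPayoff (π.act t h) (pulls h (π.act t h) + 1) :=
          (hb _ 1 _ le_rfl (by omega)).1
        have h3 := roundBound_nonneg hν (q := q) hε2 hY0 T (pulls h (π.act t h))
        simp only [hW]
        linarith
    have hint : ν.restedPayoff i (t + 1) - (histLaw ν π t).real B
        ≤ ∫ h, W (π.act t h) (pulls h (π.act t h)) ∂(histLaw ν π t) := by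
      have hBi : Integrable (B.indicator fun _ => (1 : ℝ)) (histLaw ν π t) :=
        (integrable_const _).indicator hBm
      have h1 := integral_mono ((integrable_const (ν.restedPayoff i (t + 1))).sub hBi)
        (integrable_apply_act_pulls π W (histLaw ν π t)) hpt
      simp only [Pi.sub_apply] at h1
      rw [integral_sub (integrable_const _) hBi, integral_indicator_const _ hBm] at h1
      simpa using h1
    rw [integral_pullSum_succ, integral_add (integrable_pullSum _ _)
      (integrable_apply_act_pulls π W _), Finset.sum_range_succ, Finset.sum_range_succ]
    have := ih (by omega)
    linarith

theorem pullSum_roundBound_le {ν : MAB K} (hK : 0 < K) {ε q Y : ℝ} (hε : 0 < ε) (hε2 : ε < 1 / 2)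
    (hν : ν.IsRisingRested) (hq : 0 ≤ q) (hY : 0 < Y) {T : ℕ} (hKT : (K : ℝ) < (1 - 2 * ε) * T)
    (h : Hist K T) :
    pullSum (fun _ n => roundBound ν ε q Y T n) h ≤ K * (2 / ε * (1 + 7 * Y))
      + 4 * (K * (T : ℝ) ^ q / (1 - 2 * ε)
        * ν.cumIncr ⌈(1 - 2 * ε) * (T : ℝ) / (K : ℝ)⌉₊ q) := by
  have ha : 0 < 1 - 2 * ε := by linarith
  simp only [pullSum, roundBound, Finset.sum_add_distrib, ← Finset.mul_sum]
  refine add_le_add ?_ ?_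
  · refine (Finset.sum_le_card_nsmul _ _ _ fun i _ =>
      sum_width_floor_le hε (by linarith) hY (pulls h i)).trans (le_of_eq ?_)
    rw [Finset.card_univ, Fintype.card_fin, nsmul_eq_mul]
  · have h1 := sum_ceil_le ha (by linarith) hK hKT (f := maxIncr ν q)
      (fun m hm => maxIncr_nonneg hν q hm) (fun m n hm hmn => maxIncr_antitone hK hν hq hm hmn)
      (pulls h) (sum_pulls h)
    refine (mul_le_mul_of_nonneg_left h1 (by positivity)).trans (le_of_eq ?_)
    simp only [MAB.cumIncr, maxIncr]
    ring

theorem exists_best_arm (hK : 0 < K) (ν : MAB K) (T : ℕ) :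
    ∃ i₀, ∀ i, ∑ n ∈ Finset.range T, ν.restedPayoff i (n + 1)
      ≤ ∑ n ∈ Finset.range T, ν.restedPayoff i₀ (n + 1) := by
  have : Nonempty (Fin K) := ⟨⟨0, hK⟩⟩
  exact Finite.exists_max fun i => ∑ n ∈ Finset.range T, ν.restedPayoff i (n + 1)

theorem regret_le_horizon {ν : MAB K} (hK : 0 < K) (hν : ν.IsRisingRested) (hb : ν.IsBounded)
    (π : Policy K) {T : ℕ} (hT : 0 < T) : regret ν π T ≤ T := by
  obtain ⟨i₀, hi₀⟩ := exists_best_arm hK ν T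
  have : Nonempty (Policy K) := ⟨π⟩
  have h1 : (⨆ π' : Policy K, expReward ν π' T) ≤ T := by
    refine ciSup_le fun π' => (expReward_le hν hT hi₀ π').trans ?_
    refine (Finset.sum_le_card_nsmul _ _ 1 fun n _ =>
      (hb i₀ 1 (n + 1) le_rfl (by omega)).2).trans ?_
    simp
  have h2 := expReward_nonneg hb π T
  rw [regret]
  linarith

theorem regret_le_of_width {ν : MAB K} {σ ε α q Y : ℝ} (hK : 0 < K) (hσ : 0 < σ) (hα : 0 < α)
    (hε : 0 < ε) (hε2 : ε < 1 / 2) (hν : ν.IsRisingRested) (hb : ν.IsBounded)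
    (hs : ν.IsSubgaussian σ) {π : Policy K} (hπ : π.IsREdUCB σ ε α) (hq : 0 ≤ q) (hq1 : q ≤ 1)
    {T : ℕ} (hT : 0 < T) (hY0 : 0 < Y) (hY : 2 * (σ * T * √(10 * (α * Real.log T))) ≤ Y * √Y)
    (hKT : (K : ℝ) < (1 - 2 * ε) * T) :
    regret ν π T ≤ K * (2 / ε * (1 + 7 * Y))
      + 4 * (K * (T : ℝ) ^ q / (1 - 2 * ε)
        * ν.cumIncr ⌈(1 - 2 * ε) * (T : ℝ) / (K : ℝ)⌉₊ q)
      + 2 * K * ∑ n ∈ Finset.range T, ((n + 1 : ℕ) : ℝ) ^ (1 - α) := by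
  obtain ⟨i₀, hi₀⟩ := exists_best_arm hK ν T
  have : Nonempty (Policy K) := ⟨π⟩
  have h1 := ciSup_le (expReward_le hν hT hi₀)
  have h2 := sum_payoff_le_integral hσ hα hε hε2 hν hb hs hπ hq hq1 hY0.le hY i₀ (le_refl T)
  have h3 : ∫ h, pullSum (fun j n => ν.restedPayoff j (n + 1) + roundBound ν ε q Y T n) h
      ∂(histLaw ν π T) = expReward ν π T
        + ∫ h, pullSum (fun _ n => roundBound ν ε q Y T n) h ∂(histLaw ν π T) := by
    rw [expReward_eq hν.rested, ← integral_add (integrable_pullSum _ _) (integrable_pullSum _ _)]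
    simp only [pullSum, Finset.sum_add_distrib]
  have h4 := integral_mono (integrable_pullSum (fun _ n => roundBound ν ε q Y T n) (histLaw ν π T))
    (integrable_const _) (pullSum_roundBound_le hK hε hε2 hν hq hY0 hKT)
  rw [integral_const, probReal_univ, one_smul] at h4
  rw [← Finset.mul_sum, h3] at h2
  rw [regret]
  linarith

/-! ### The rate -/

/-- The factor `(σ T)^{2/3} (α log T)^{1/3}` of the rate. -/
def noiseRate (σ α : ℝ) (T : ℕ) : ℝ :=
  (σ * (T : ℝ)) ^ (2 / 3 : ℝ) * (α * Real.log (T : ℝ)) ^ (1 / 3 : ℝ)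

theorem noiseRate_pos {σ α : ℝ} (hσ : 0 < σ) (hα : 0 < α) {T : ℕ} (hT : 2 ≤ T) :
    0 < noiseRate σ α T := by
  have h1 : (2 : ℝ) ≤ T := by exact_mod_cast hT
  have h2 : 0 < Real.log T := Real.log_pos (by linarith)
  unfold noiseRate
  positivity

theorem noiseRate_mono {σ α : ℝ} (hσ : 0 < σ) (hα : 0 < α) {T T' : ℕ} (hT : 2 ≤ T)
    (hTT' : T ≤ T') : noiseRate σ α T ≤ noiseRate σ α T' := by
  have h1 : (2 : ℝ) ≤ T := by exact_mod_cast hT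
  have h2 : 0 < Real.log T := Real.log_pos (by linarith)
  have h3 : (T : ℝ) ≤ T' := by exact_mod_cast hTT'
  unfold noiseRate
  gcongr

theorem noiseRate_mul_sqrt {σ α : ℝ} (hσ : 0 < σ) (hα : 0 < α) {T : ℕ} (hT : 2 ≤ T) :
    noiseRate σ α T * √(noiseRate σ α T) = σ * T * √(α * Real.log T) := by
  have h1 : (2 : ℝ) ≤ T := by exact_mod_cast hT
  have h2 : 0 < Real.log T := Real.log_pos (by linarith)
  have h3 : 0 < σ * T := by positivity
  have h4 : 0 < α * Real.log T := by positivity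
  have h5 := noiseRate_pos hσ hα hT
  have h6 : noiseRate σ α T * √(noiseRate σ α T) = noiseRate σ α T ^ (3 / 2 : ℝ) := by
    rw [Real.sqrt_eq_rpow, ← Real.rpow_one_add' h5.le (by norm_num)]
    norm_num
  rw [h6, noiseRate, Real.mul_rpow (by positivity) (by positivity), ← Real.rpow_mul h3.le,
    ← Real.rpow_mul h4.le, Real.sqrt_eq_rpow]
  norm_num

theorem tendsto_noiseRate {σ α : ℝ} (hσ : 0 < σ) (hα : 0 < α) :
    Filter.Tendsto (noiseRate σ α) Filter.atTop Filter.atTop := by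
  have h1 : Filter.Tendsto (fun T : ℕ => (σ * (T : ℝ)) ^ (2 / 3 : ℝ)) Filter.atTop Filter.atTop :=
    (tendsto_rpow_atTop (by norm_num)).comp
      (tendsto_natCast_atTop_atTop.const_mul_atTop hσ)
  have h2 : Filter.Tendsto (fun T : ℕ => (α * Real.log (T : ℝ)) ^ (1 / 3 : ℝ)) Filter.atTop
      Filter.atTop :=
    (tendsto_rpow_atTop (by norm_num)).comp
      ((Real.tendsto_log_atTop.comp tendsto_natCast_atTop_atTop).const_mul_atTop hα)
  exact h1.atTop_mul_atTop₀ h2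

theorem summable_succ_rpow {α : ℝ} (hα : 2 < α) :
    Summable fun n : ℕ => ((n + 1 : ℕ) : ℝ) ^ (1 - α) :=
  (summable_nat_add_iff (f := fun n : ℕ => (n : ℝ) ^ (1 - α)) 1).2
    (Real.summable_nat_rpow.2 (by linarith))

theorem cumIncr_nonneg {ν : MAB K} (hν : ν.IsRisingRested) (M : ℕ) (q : ℝ) :
    0 ≤ ν.cumIncr M q :=
  Finset.sum_nonneg fun _ hl => maxIncr_nonneg hν q (Finset.mem_Ico.1 hl).1

theorem regretRate_eq (ν : MAB K) (σ ε α q : ℝ) (T : ℕ) :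
    regretRate ν σ ε α q T = (K : ℝ) / ε * noiseRate σ α T
      + (K : ℝ) * (T : ℝ) ^ q / (1 - 2 * ε)
        * ν.cumIncr ⌈(1 - 2 * ε) * (T : ℝ) / (K : ℝ)⌉₊ q := by
  rw [regretRate, noiseRate, ← mul_assoc]

/-- The absolute constant: as soon as `noiseRate` exceeds the expected number of rounds outside
the good event, up to the factor `2 K`, the regret is at most `57` times the rate. -/
theorem regret_le_regretRate {ν : MAB K} {σ ε α q : ℝ} (hK : 0 < K) (hσ : 0 < σ) (hα : 2 < α)
    (hε : 0 < ε) (hε2 : ε < 1 / 2) (hν : ν.IsRisingRested) (hb : ν.IsBounded)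
    (hs : ν.IsSubgaussian σ) {π : Policy K} (hπ : π.IsREdUCB σ ε α) (hq : 0 ≤ q) (hq1 : q ≤ 1)
    {T : ℕ} (hT : 2 ≤ T)
    (hTZ : 2 + ∑' n : ℕ, ((n + 1 : ℕ) : ℝ) ^ (1 - α) ≤ noiseRate σ α T)
    (hKT : (K : ℝ) < (1 - 2 * ε) * T) :
    regret ν π T ≤ 57 * regretRate ν σ ε α q T := by
  have hα0 : 0 < α := by linarith
  have hZ := noiseRate_pos hσ hα0 hT
  set Z := noiseRate σ α T with hZdef
  set P := ∑' n : ℕ, ((n + 1 : ℕ) : ℝ) ^ (1 - α) with hP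
  -- the factor `4` is chosen because `2 √10 ≤ 4 ^ (3/2)`
  have hY : 2 * (σ * T * √(10 * (α * Real.log T))) ≤ (4 * Z) * √(4 * Z) := by
    have h1 : √(4 * Z) = 2 * √Z := by
      rw [Real.sqrt_mul (by norm_num), show (4 : ℝ) = 2 ^ 2 by norm_num, Real.sqrt_sq (by norm_num)]
    have h2 : √10 ≤ (4 : ℝ) := Real.sqrt_le_iff.2 (by norm_num)
    have h3 := noiseRate_mul_sqrt hσ hα0 hT
    rw [← hZdef] at h3
    rw [h1, Real.sqrt_mul (by norm_num), show 4 * Z * (2 * √Z) = 8 * (Z * √Z) by ring, h3]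
    have h4 : 0 ≤ σ * T * √(α * Real.log T) := by positivity
    nlinarith
  have hmain := regret_le_of_width hK hσ hα0 hε hε2 hν hb hs hπ hq hq1 (by omega)
    (by positivity : 0 < 4 * Z) hY hKT
  have hPle : ∑ n ∈ Finset.range T, ((n + 1 : ℕ) : ℝ) ^ (1 - α) ≤ P :=
    (summable_succ_rpow hα).sum_le_tsum _ fun n _ => by positivity
  have hP0 : 0 ≤ P := tsum_nonneg fun n => by positivity
  have hU := cumIncr_nonneg hν ⌈(1 - 2 * ε) * (T : ℝ) / (K : ℝ)⌉₊ q
  set R := (K : ℝ) * (T : ℝ) ^ q / (1 - 2 * ε)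
    * ν.cumIncr ⌈(1 - 2 * ε) * (T : ℝ) / (K : ℝ)⌉₊ q with hR
  have hR0 : 0 ≤ R := mul_nonneg (div_nonneg (by positivity) (by linarith)) hU
  rw [regretRate_eq, ← hZdef, ← hR]
  have hE : 2 ≤ 1 / ε := by
    rw [le_div_iff₀ hε]
    linarith
  have h5 : 2 * (K : ℝ) * ∑ n ∈ Finset.range T, ((n + 1 : ℕ) : ℝ) ^ (1 - α) ≤ K / ε * P :=
    calc _ ≤ 2 * (K : ℝ) * P := by gcongr
      _ = 2 * (K * P) := by ring
      _ ≤ 1 / ε * (K * P) := by gcongr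
      _ = K / ε * P := by ring
  have h6 : (K : ℝ) * (2 / ε * (1 + 7 * (4 * Z))) + K / ε * P ≤ 57 * (K / ε * Z) :=
    calc _ = K / ε * (2 + P + 56 * Z) := by ring
      _ ≤ K / ε * (Z + 56 * Z) := by gcongr
      _ = _ := by ring
  linarith

theorem noiseRate_le_regretRate {ν : MAB K} {σ ε α : ℝ} (hσ : 0 < σ) (hα : 0 < α)
    (hε : 0 < ε) (hε2 : ε < 1 / 2) (hν : ν.IsRisingRested) (q : ℝ) {T : ℕ} (hT : 2 ≤ T) :
    (K : ℝ) * noiseRate σ α 2 ≤ regretRate ν σ ε α q T := by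
  have hU := cumIncr_nonneg hν ⌈(1 - 2 * ε) * (T : ℝ) / (K : ℝ)⌉₊ q
  have hR : 0 ≤ (K : ℝ) * (T : ℝ) ^ q / (1 - 2 * ε)
      * ν.cumIncr ⌈(1 - 2 * ε) * (T : ℝ) / (K : ℝ)⌉₊ q :=
    mul_nonneg (div_nonneg (by positivity) (by linarith)) hU
  have h1 : (K : ℝ) ≤ K / ε := le_div_self (Nat.cast_nonneg K) hε (by linarith)
  have h2 : (K : ℝ) * noiseRate σ α 2 ≤ K / ε * noiseRate σ α T :=
    mul_le_mul h1 (noiseRate_mono hσ hα le_rfl hT) (noiseRate_pos hσ hα le_rfl).le (by positivity)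
  rw [regretRate_eq]
  linarith

end RisingBandit

end

theorem mainTheorem4 :
    ∃ C : ℝ, 0 < C ∧ ∀ σ α : ℝ, 0 < σ → 2 < α → ∃ T₀ : ℕ,
      ∀ ε : ℝ, 0 < ε → ε < 1 / 2 → ∃ D : ℝ, 0 < D ∧
        ∀ (K : ℕ) (ν : RisingBandit.MAB K) (π : RisingBandit.Policy K) (T : ℕ) (q : ℝ),
          0 < K → ν.IsRisingRested → ν.IsBounded → ν.IsSubgaussian σ → π.IsREdUCB σ ε α →
          2 ≤ T → 0 ≤ q → q ≤ 1 →
            RisingBandit.regret ν π T ≤ D * RisingBandit.regretRate ν σ ε α q T ∧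
            (T₀ ≤ T → (K : ℝ) < (1 - 2 * ε) * (T : ℝ) →
              RisingBandit.regret ν π T ≤ C * RisingBandit.regretRate ν σ ε α q T) := by
  refine ⟨57, by norm_num, fun σ α hσ hα => ?_⟩
  have hα0 : 0 < α := by linarith
  obtain ⟨T₀, hT₀⟩ := Filter.eventually_atTop.1
    ((RisingBandit.tendsto_noiseRate hσ hα0).eventually_ge_atTop
    (2 + ∑' n : ℕ, ((n + 1 : ℕ) : ℝ) ^ (1 - α)))
  refine ⟨T₀, fun ε hε hε2 => ?_⟩
  have ha : 0 < 1 - 2 * ε := by linarith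
  have hZ := RisingBandit.noiseRate_pos hσ hα0 (le_refl 2)
  set Z := RisingBandit.noiseRate σ α 2 with hZdef
  -- the second summand absorbs the bound `T` where the first one is not available
  refine ⟨57 + (T₀ + 1 / (1 - 2 * ε)) / Z, by positivity, ?_⟩
  intro K ν π T q hK hν hb hs hπ hT hq hq1
  have hlarge : T₀ ≤ T → (K : ℝ) < (1 - 2 * ε) * (T : ℝ) →
      RisingBandit.regret ν π T ≤ 57 * RisingBandit.regretRate ν σ ε α q T := fun h1 h2 =>
    RisingBandit.regret_le_regretRate hK hσ hα hε hε2 hν hb hs hπ hq hq1 hT (hT₀ T h1) h2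
  refine ⟨?_, hlarge⟩
  have hK' : (1 : ℝ) ≤ K := by exact_mod_cast hK
  have hrate := RisingBandit.noiseRate_le_regretRate hσ hα0 hε hε2 hν q hT
  rw [← hZdef] at hrate
  set R := RisingBandit.regretRate ν σ ε α q T with hR
  have hR0 : 0 ≤ R := le_trans (by positivity) hrate
  by_cases hcase : T₀ ≤ T ∧ (K : ℝ) < (1 - 2 * ε) * (T : ℝ)
  · have h1 : 0 ≤ (T₀ + 1 / (1 - 2 * ε)) / Z * R := by positivity
    have h2 := hlarge hcase.1 hcase.2
    linarith
  · -- for the remaining horizons the trivial bound `T` is at most `K (T₀ + 1 / (1 - 2 ε))`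
    have h1 := RisingBandit.regret_le_horizon hK hν hb π (T := T) (by omega)
    have h2 : (T : ℝ) ≤ (T₀ + 1 / (1 - 2 * ε)) * K := by
      rcases not_and_or.1 hcase with h | h
      · have h3 : (T : ℝ) ≤ T₀ := by exact_mod_cast (not_le.1 h).le
        have h4 : 0 < 1 / (1 - 2 * ε) := by positivity
        have h5 : (0 : ℝ) ≤ T₀ := Nat.cast_nonneg _
        nlinarith
      · have h3 : (T : ℝ) ≤ 1 / (1 - 2 * ε) * K := by
          rw [div_mul_eq_mul_div, one_mul, le_div_iff₀ ha]
          linarith [not_lt.1 h]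
        have h5 : (0 : ℝ) ≤ T₀ * K := by positivity
        linarith
    have h3 : (T₀ + 1 / (1 - 2 * ε)) * K ≤ (T₀ + 1 / (1 - 2 * ε)) / Z * R :=
      calc _ = (T₀ + 1 / (1 - 2 * ε)) / Z * (K * Z) := by field_simp
        _ ≤ _ := by gcongr
    linarith
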